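/- **Algorithm for $R_D$.** Let $x,y,z\in\mathbb C$, where $z\in\mathbb C\setminus(-\infty,0]$, each of $x,y$ is $0$ or lies in the cut plane $\mathbb C\setminus(-\infty,0]$, and $x,y$ are not both $0$. Put $$R_D(x,y,z)=\frac32\int_0^\infty [(t+x)(t+y)]^{-1/2}(t+z)^{-3/2}\,dt ,$$ where $[(t+x)(t+y)]^{-1/2}(t+z)^{-3/2}$ means the product of the principal powers $(t+x)^{-1/2}(t+y)^{-1/2}(t+z)^{-3/2}$. Let $0<r<10^{-4}$, and let $(x_0,y_0,z_0)=(x,y,z)$, $A_0=\frac{x+y+3z}{5}$, $Q=(r/4)^{-1/6}\max\{|A_0-x|,|A_0-y|,|A_0-z|\}$. For $m\ge0$ let $$\lambda_m=\sqrt{x_m}\sqrt{y_m}+\sqrt{x_m}\sqrt{z_m}+\sqrt{y_m}\sqrt{z_m},\quad A_{m+1}=\frac{A_m+\lambda_m}4,\quad (x_{m+1},y_{m+1},z_{m+1})=\frac{(x_m+\lambda_m,\;y_m+\lambda_m,\;z_m+\lambda_m)}4,$$ with square roots of nonnegative real part. For $n\ge 0$ let $X=\frac{A_0-x}{4^nA_n}$,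 $Y=\frac{A_0-y}{4^nA_n}$, $Z=-\frac{X+Y}3$, $E_2=XY-6Z^2$, $E_3=(3XY-8Z^2)Z$, $E_4=3(XY-Z^2)Z^2$, $E_5=XYZ^3$, and $$T_n=4^{-n}A_n^{-3/2}\Bigl(1-\tfrac3{14}E_2+\tfrac16E_3+\tfrac9{88}E_2^2-\tfrac3{22}E_4-\tfrac9{52}E_2E_3+\tfrac3{26}E_5\Bigr),\qquad S_n=3\sum_{m=0}^{n-1}\frac{4^{-m}}{\sqrt{z_m}\,(z_m+\lambda_m)},$$ where $A_n^{-3/2}$ is the principal power. Say that $c$ approximates $v$ with relative error less than $r$ if $|v-c|<r|c|$. Then: 1. For every $m$ the triple $(x_m,y_m,z_m)$ satisfies the conditions imposed on $(x,y,z)$, the integrand of $R_D(x_m,y_m,z_m)$ is integrable on $(0,\infty)$, and $\sqrt{z_m}(z_m+\lambda_m)\ne0$. 2. The stopping criterion $4^{-n}Q<|A_n|$ holds for all sufficiently large $n$. 3. For every $n\ge0$, $R_D(x,y,z)=4^{-n}R_D(x_n,y_n,z_n)+S_n$. 4. Let $n$ satisfy the stopping criterion and, in case $n=0$, let the convex hull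 of $\{x,y,z\}$ lie in the cut plane. Then $A_n$ lies in the cut plane, $T_n$ approximates $4^{-n}R_D(x_n,y_n,z_n)$ with relative error less than $r$, and therefore $|R_D(x,y,z)-(T_n+S_n)|<r|T_n|$. In particular $T_n+S_n$ approximates $R_D(x,y,z)$ with relative error less than $r$ unless the two terms cancel so far that $|T_n+S_n|<|T_n|$. 5. If $x,y,z$ are real (hence nonnegative), then for every $n$ that satisfies the stopping criterion, $T_n+S_n$ approximates $R_D(x,y,z)$ with relative error less than $r$. -/

import Mathlib

open MeasureTheory Filter

namespace Carlson

/-- The integrand `[(t + x)(t + y)]^{-1/2} (t + z)^{-3/2}` of `R_D`. Each factor is a principal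
power; for `t > 0` and variables that are `0` or in the cut plane, every `t + x` is in the cut
plane, so this is the branch that is positive for positive variables, continued continuously. -/
noncomputable def rdIntegrand (x y z : ℂ) (t : ℝ) : ℂ :=
  ((t : ℂ) + x) ^ (-(1 / 2) : ℂ) * ((t : ℂ) + y) ^ (-(1 / 2) : ℂ) *
    ((t : ℂ) + z) ^ (-(3 / 2) : ℂ)

/-- The degenerate symmetric elliptic integral of the second kind `R_D(x, y, z)`. -/
noncomputable def RD (x y z : ℂ) : ℂ :=
  (3 / 2) * ∫ t in Set.Ioi (0 : ℝ), rdIntegrand x y z t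

/-- `(x, y, z)` is an admissible triple of variables for `R_D`: the variables lie in the plane cut
along the nonpositive real axis, except that at most one of `x` and `y` may be `0`. -/
def Admissible (x y z : ℂ) : Prop :=
  (x = 0 ∨ x ∈ Complex.slitPlane) ∧ (y = 0 ∨ y ∈ Complex.slitPlane) ∧
    z ∈ Complex.slitPlane ∧ ¬ (x = 0 ∧ y = 0)

/-- `λ = √x √y + √x √z + √y √z`, with square roots of nonnegative real part. -/
noncomputable def lam (x y z : ℂ) : ℂ :=
  x.sqrt * y.sqrt + x.sqrt * z.sqrt + y.sqrt * z.sqrt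

/-- The principal square root is a square root. -/
theorem sqrt_sq (w : ℂ) : w.sqrt ^ 2 = w := by
  unfold Complex.sqrt
  exact_mod_cast Complex.cpow_nat_inv_pow w (n := 2) two_ne_zero

/-- The principal square root has nonnegative real part. -/
theorem sqrt_re_nonneg (w : ℂ) : 0 ≤ w.sqrt.re := by
  unfold Complex.sqrt
  rw [Complex.cpow_inv_two_re]
  exact Real.sqrt_nonneg _

/-- The triple `(x_m, y_m, z_m)` produced by `m` duplication steps from `(x, y, z)`. -/
noncomputable def iter (x y z : ℂ) : ℕ → ℂ × ℂ × ℂ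
  | 0 => (x, y, z)
  | m + 1 =>
    let v := iter x y z m
    ((v.1 + lam v.1 v.2.1 v.2.2) / 4, (v.2.1 + lam v.1 v.2.1 v.2.2) / 4,
      (v.2.2 + lam v.1 v.2.1 v.2.2) / 4)

/-- `x_m`. -/
noncomputable def xs (x y z : ℂ) (m : ℕ) : ℂ := (iter x y z m).1

/-- `y_m`. -/
noncomputable def ys (x y z : ℂ) (m : ℕ) : ℂ := (iter x y z m).2.1

/-- `z_m`. -/
noncomputable def zs (x y z : ℂ) (m : ℕ) : ℂ := (iter x y z m).2.2

/-- `λ_m`. -/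
noncomputable def lams (x y z : ℂ) (m : ℕ) : ℂ := lam (xs x y z m) (ys x y z m) (zs x y z m)

/-- `A_m`: `A_0 = (x + y + 3 z) / 5` and `A_{m+1} = (A_m + λ_m) / 4`. -/
noncomputable def A (x y z : ℂ) : ℕ → ℂ
  | 0 => (x + y + 3 * z) / 5
  | m + 1 => (A x y z m + lams x y z m) / 4

/-- `Q = (r/4)^{-1/6} max {|A_0 - x|, |A_0 - y|, |A_0 - z|}`. -/
noncomputable def Q (r : ℝ) (x y z : ℂ) : ℝ :=
  (r / 4) ^ (-(1 / 6) : ℝ) * max (max ‖A x y z 0 - x‖ ‖A x y z 0 - y‖) ‖A x y z 0 - z‖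

/-- The stopping criterion `4^{-n} Q < |A_n|`. -/
def Stop (r : ℝ) (x y z : ℂ) (n : ℕ) : Prop :=
  ((4 : ℝ) ^ n)⁻¹ * Q r x y z < ‖A x y z n‖

/-- `X = (A_0 - x) / (4^n A_n)`. -/
noncomputable def X (x y z : ℂ) (n : ℕ) : ℂ := (A x y z 0 - x) / (4 ^ n * A x y z n)

/-- `Y = (A_0 - y) / (4^n A_n)`. -/
noncomputable def Y (x y z : ℂ) (n : ℕ) : ℂ := (A x y z 0 - y) / (4 ^ n * A x y z n)

/-- `Z = -(X + Y) / 3`. -/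
noncomputable def Z (x y z : ℂ) (n : ℕ) : ℂ := -(X x y z n + Y x y z n) / 3

/-- The truncated power series, as a function of `E_2, E_3, E_4, E_5`. -/
noncomputable def series (E2 E3 E4 E5 : ℂ) : ℂ :=
  1 - 3 / 14 * E2 + 1 / 6 * E3 + 9 / 88 * E2 ^ 2 - 3 / 22 * E4 - 9 / 52 * (E2 * E3) + 3 / 26 * E5

/-- The truncated power series with
`E_2 = XY - 6Z²`, `E_3 = (3XY - 8Z²)Z`, `E_4 = 3(XY - Z²)Z²`, `E_5 = XYZ³`. -/
noncomputable def poly (X Y Z : ℂ) : ℂ :=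
  series (X * Y - 6 * Z ^ 2) ((3 * (X * Y) - 8 * Z ^ 2) * Z)
    (3 * (X * Y - Z ^ 2) * Z ^ 2) (X * Y * Z ^ 3)

/-- The power-series term `4^{-n} A_n^{-3/2} (1 - (3/14) E_2 + ⋯ + (3/26) E_5)`. -/
noncomputable def mainTerm (x y z : ℂ) (n : ℕ) : ℂ :=
  ((4 : ℂ) ^ n)⁻¹ * A x y z n ^ (-(3 / 2) : ℂ) * poly (X x y z n) (Y x y z n) (Z x y z n)

/-- The sum `3 ∑_{m < n} 4^{-m} / (√z_m (z_m + λ_m))`. -/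
noncomputable def sumTerm (x y z : ℂ) (n : ℕ) : ℂ :=
  3 * ∑ m ∈ Finset.range n,
    ((4 : ℂ) ^ m)⁻¹ / ((zs x y z m).sqrt * (zs x y z m + lams x y z m))

/-- The value computed by the algorithm with `n` duplications. -/
noncomputable def approx (x y z : ℂ) (n : ℕ) : ℂ := mainTerm x y z n + sumTerm x y z n

/-- The computed value `c` approximates the true value `v` with relative error less than `r`:
`v` lies inside the circle with center `c` and radius `r * |c|`. -/
def RelErrorLT (r : ℝ) (v c : ℂ) : Prop := ‖v - c‖ < r * ‖c‖

end Carlson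

/-! Duplication. Under the shift (x+t, y+t, z+t) the integrand of R_D depends only on t plus the
integration variable, so the t-derivative of R_D is -3/2 times the integrand at t
(`hasDerivAt_RD_add`). The right side of the duplication formula has the same derivative, by an
algebraic identity in √x, √y, √z, and tends to 0 as t → ∞; the fundamental theorem of calculus then
gives the formula (`RD_eq_duplicated`), and induction gives its iterated form.

Branches are controlled by factoring each new variable into two averages such as (√x+√y)/2. These
lie in the right half-plane, so the product lies in the cut plane and its root is the product of the
roots. A lower bound δ for the real parts of the roots survives every step (`le_re_sqrt_step`).
Hence 4^{-n} R_D(x_n, y_n, z_n) → 0, so S_n → R_D, and |A_n| is eventually bounded below, which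
yields the stopping criterion.

Error. One has x_n = A_n(1-X), y_n = A_n(1-Y), z_n = A_n(1-Z). The complex factor A_n is pulled out
of R_D without rotating a contour: every S_n is homogeneous, hence so is the limit R_D (`RD_mul`).
The branch condition Re(√A_n √(1-X)) > 0 follows by continuity along a segment in the convex hull of
the n-th triple, and that hull avoids the cut automatically after one duplication (`convexCut_mul`).
What remains is R_D near (1,1,1). Since X+Y+3Z = 0, (1-X)(1-Y)(1-Z)³ = 1+E₂-E₃+E₄-E₅; integrating
the degree-5 Taylor polynomial of its inverse square root gives the series with error at most 2ρ⁶,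
where ρ = (r/4)^{1/6}. This is r/2, while the series has modulus at least 0.9. For real variables
T_n and S_n are nonnegative, so no cancellation occurs. -/

namespace Carlson

/-! ### Principal square roots and the right half-plane -/

lemma re_sq_eq (w : ℂ) : w.sqrt.re ^ 2 - w.sqrt.im ^ 2 = w.re := by
  have h := congrArg Complex.re (sqrt_sq w)
  simp only [sq, Complex.mul_re] at h
  linarith

lemma sqrt_re_pos {w : ℂ} (h : w ∈ Complex.slitPlane) : 0 < w.sqrt.re := by
  rcases (sqrt_re_nonneg w).lt_or_eq with h0 | h0
  · exact h0
  · exfalso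
    have h1 := re_sq_eq w
    have h2 := congrArg Complex.im (sqrt_sq w)
    simp only [sq, Complex.mul_im, ← h0] at h1 h2
    rcases Complex.mem_slitPlane_iff.1 h with h3 | h3
    · nlinarith [mul_self_nonneg w.sqrt.im]
    · apply h3; linarith

lemma sqrt_ne_zero {w : ℂ} (h : w ∈ Complex.slitPlane) : w.sqrt ≠ 0 := by
  intro h0
  have := sqrt_re_pos h
  simp [h0] at this

lemma sqrt_eq_of_sq {w s : ℂ} (h : s ^ 2 = w) (hs : 0 < s.re) : w.sqrt = s := by
  rcases sq_eq_sq_iff_eq_or_eq_neg.1 ((sqrt_sq w).trans h.symm) with h1 | h1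
  · exact h1
  · have := sqrt_re_nonneg w
    rw [h1, Complex.neg_re] at this
    linarith

/-- The arguments of p and q lie in (-π/2, π/2), so they add up to one in (-π, π). In coordinates:
if pq is real, then Re p · Re(pq) = |p|² Re q > 0. -/
lemma mul_mem_slitPlane {p q : ℂ} (hp : 0 < p.re) (hq : 0 < q.re) :
    p * q ∈ Complex.slitPlane := by
  rw [Complex.mem_slitPlane_iff]
  by_cases h : (p * q).im = 0
  · left
    simp only [Complex.mul_im, Complex.mul_re] at h ⊢
    by_contra! h1
    have h2 : p.re * (p.re * q.re - p.im * q.im) = p.re ^ 2 * q.re + p.im ^ 2 * q.re := by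
      linear_combination (-p.im) * h
    have h3 : 0 < p.re ^ 2 * q.re := by positivity
    have h4 : 0 ≤ p.im ^ 2 * q.re := by positivity
    nlinarith
  · exact Or.inr h

lemma sq_mem_slitPlane {s : ℂ} (hs : 0 < s.re) : s ^ 2 ∈ Complex.slitPlane := by
  rw [sq]; exact mul_mem_slitPlane hs hs

lemma mem_slitPlane_of_sqrt_re_pos {w : ℂ} (h : 0 < w.sqrt.re) : w ∈ Complex.slitPlane := by
  rw [← sqrt_sq w]; exact sq_mem_slitPlane h

lemma norm_sqrt_sq (w : ℂ) : ‖w.sqrt‖ ^ 2 = ‖w‖ := by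
  rw [← norm_pow, sqrt_sq]

lemma cpow_neg_half (w : ℂ) : w ^ (-(1 / 2) : ℂ) = (w.sqrt)⁻¹ := by
  rw [Complex.cpow_neg, Complex.sqrt]; norm_num

lemma cpow_neg_three_half (w : ℂ) : w ^ (-(3 / 2) : ℂ) = (w.sqrt ^ 3)⁻¹ := by
  rw [Complex.cpow_neg, Complex.sqrt, ← Complex.cpow_nat_mul]; norm_num

/-- If `w₁²` and `w₂²` have real part at least `δ`, then so has `w₁ w₂`. -/
lemma le_re_mul_of_le_re_sq {w₁ w₂ : ℂ} {δ : ℝ} (hδ : 0 < δ) (h₁ : 0 ≤ w₁.re) (h₂ : 0 ≤ w₂.re)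
    (h₁' : δ ≤ w₁.re ^ 2 - w₁.im ^ 2) (h₂' : δ ≤ w₂.re ^ 2 - w₂.im ^ 2) :
    δ ≤ (w₁ * w₂).re := by
  rw [Complex.mul_re]
  have a1 : |w₁.im| ≤ w₁.re := abs_le_of_sq_le_sq (by linarith) h₁
  have a2 : |w₂.im| ≤ w₂.re := abs_le_of_sq_le_sq (by linarith) h₂
  have h3 : w₁.im * w₂.im ≤ w₁.re * w₂.re := by
    calc w₁.im * w₂.im ≤ |w₁.im * w₂.im| := le_abs_self _
      _ = |w₁.im| * |w₂.im| := abs_mul _ _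
      _ ≤ _ := mul_le_mul a1 a2 (abs_nonneg _) h₁
  refine le_of_sq_le_sq (a := δ) ?_ (by linarith)
  have h4 := mul_le_mul h₁' h₂' hδ.le (by linarith)
  -- (Re w₁w₂)² = Re(w₁²) Re(w₂²) + (Re w₁ Im w₂ - Re w₂ Im w₁)².
  nlinarith [sq_nonneg (w₁.re * w₂.im - w₂.re * w₁.im)]

/-- If `w₁²` and `w₂²` have positive real part, then so has `w₁ w₂`. -/
lemma re_mul_pos_of_re_sq_pos {w₁ w₂ : ℂ} (h₁ : 0 ≤ w₁.re) (h₂ : 0 ≤ w₂.re)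
    (h₁' : 0 < (w₁ ^ 2).re) (h₂' : 0 < (w₂ ^ 2).re) : 0 < (w₁ * w₂).re := by
  have e : ∀ w : ℂ, (w ^ 2).re = w.re ^ 2 - w.im ^ 2 := fun w => by
    rw [sq, Complex.mul_re]; ring
  rw [e] at h₁' h₂'
  exact (lt_min h₁' h₂').trans_le (le_re_mul_of_le_re_sq (lt_min h₁' h₂') h₁ h₂
    (min_le_left _ _) (min_le_right _ _))

lemma le_re_sqrt_mul_sqrt {p q : ℂ} {δ : ℝ} (hδ : 0 < δ) (hp : δ ≤ p.re) (hq : δ ≤ q.re) :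
    δ ≤ (p.sqrt * q.sqrt).re :=
  le_re_mul_of_le_re_sq hδ (sqrt_re_nonneg _) (sqrt_re_nonneg _)
    (by rw [re_sq_eq]; exact hp) (by rw [re_sq_eq]; exact hq)

lemma re_sqrt_mul_sqrt_pos {p q : ℂ} (hp : 0 < p.re) (hq : 0 < q.re) :
    0 < (p.sqrt * q.sqrt).re :=
  (lt_min hp hq).trans_le
    (le_re_sqrt_mul_sqrt (lt_min hp hq) (min_le_left _ _) (min_le_right _ _))

lemma sqrt_mul_of_re_pos {p q : ℂ} (hp : 0 < p.re) (hq : 0 < q.re) :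
    (p * q).sqrt = p.sqrt * q.sqrt :=
  sqrt_eq_of_sq (by rw [mul_pow, sqrt_sq, sqrt_sq]) (re_sqrt_mul_sqrt_pos hp hq)

lemma sqrt_ofReal {t : ℝ} (ht : 0 < t) : (t : ℂ).sqrt = (√t : ℝ) :=
  sqrt_eq_of_sq (by rw [← Complex.ofReal_pow, Real.sq_sqrt ht.le]) (by simpa using ht)

lemma continuousAt_sqrt_zero : ContinuousAt Complex.sqrt 0 := by
  rw [ContinuousAt, Complex.sqrt_zero, tendsto_zero_iff_norm_tendsto_zero]
  have h : ∀ w : ℂ, ‖w.sqrt‖ = √‖w‖ := fun w => by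
    rw [← norm_sqrt_sq w, Real.sqrt_sq (norm_nonneg _)]
  simp only [h]
  have : Continuous fun w : ℂ => √‖w‖ := by fun_prop
  simpa using this.tendsto 0

lemma hasDerivAt_sqrt {w : ℂ} (h : w ∈ Complex.slitPlane) :
    HasDerivAt Complex.sqrt (1 / (2 * w.sqrt)) w := by
  have h1 := (hasDerivAt_id w).cpow_const (c := 2⁻¹) h
  have h2 : (id w : ℂ) ^ ((2 : ℂ)⁻¹ - 1) = (w.sqrt)⁻¹ := by
    rw [← cpow_neg_half]; norm_num
  rw [h2] at h1
  refine h1.congr_deriv ?_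
  have := sqrt_ne_zero h
  field_simp

lemma continuousAt_sqrt {w : ℂ} (h : w = 0 ∨ w ∈ Complex.slitPlane) :
    ContinuousAt Complex.sqrt w := by
  rcases h with rfl | h
  · exact continuousAt_sqrt_zero
  · exact (hasDerivAt_sqrt h).continuousAt

lemma ofReal_add_mem_slitPlane {w : ℂ} (h : w = 0 ∨ w ∈ Complex.slitPlane) {t : ℝ} (ht : 0 < t) :
    (t : ℂ) + w ∈ Complex.slitPlane := by
  rcases h with rfl | h
  · simpa using ht
  · rw [Complex.mem_slitPlane_iff] at h ⊢
    simp only [Complex.add_re, Complex.ofReal_re, Complex.add_im, Complex.ofReal_im, zero_add]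
    rcases h with h | h
    · left; linarith
    · right; exact h

/-! ### Bounds and integrability of the integrand -/

lemma rdIntegrand_eq (x y z : ℂ) (t : ℝ) :
    rdIntegrand x y z t =
      (((t : ℂ) + x).sqrt * ((t : ℂ) + y).sqrt * ((t : ℂ) + z).sqrt ^ 3)⁻¹ := by
  rw [rdIntegrand, cpow_neg_half, cpow_neg_half, cpow_neg_three_half, mul_inv, mul_inv]

lemma rdIntegrand_comm (x y z : ℂ) (t : ℝ) : rdIntegrand x y z t = rdIntegrand y x z t := by
  rw [rdIntegrand_eq, rdIntegrand_eq, mul_comm (((t : ℂ) + x).sqrt)]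

lemma continuousOn_rdIntegrand {x y z : ℂ} (hx : x = 0 ∨ x ∈ Complex.slitPlane)
    (hy : y = 0 ∨ y ∈ Complex.slitPlane) (hz : z ∈ Complex.slitPlane) :
    ContinuousOn (rdIntegrand x y z) (Set.Ioi 0) := by
  have h : ∀ w : ℂ, w = 0 ∨ w ∈ Complex.slitPlane →
      ContinuousOn (fun t : ℝ => ((t : ℂ) + w).sqrt) (Set.Ioi 0) := by
    intro w hw t ht
    refine ContinuousAt.continuousWithinAt ?_
    refine ContinuousAt.comp (f := fun t : ℝ => (t : ℂ) + w) (g := Complex.sqrt)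
      (continuousAt_sqrt (Or.inr (ofReal_add_mem_slitPlane hw ht))) ?_
    fun_prop
  have hn : ∀ w : ℂ, w = 0 ∨ w ∈ Complex.slitPlane → ∀ t ∈ Set.Ioi (0 : ℝ),
      ((t : ℂ) + w).sqrt ≠ 0 := fun w hw t ht => sqrt_ne_zero (ofReal_add_mem_slitPlane hw ht)
  have e : rdIntegrand x y z = fun t : ℝ =>
      (((t : ℂ) + x).sqrt * ((t : ℂ) + y).sqrt * ((t : ℂ) + z).sqrt ^ 3)⁻¹ :=
    funext (rdIntegrand_eq x y z)
  rw [e]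
  refine ContinuousOn.inv₀ (((h x hx).mul (h y hy)).mul ((h z (Or.inr hz)).pow 3)) ?_
  intro t ht
  exact mul_ne_zero (mul_ne_zero (hn x hx t ht) (hn y hy t ht))
    (pow_ne_zero _ (hn z (Or.inr hz) t ht))

lemma aestronglyMeasurable_rdIntegrand {x y z : ℂ} (hx : x = 0 ∨ x ∈ Complex.slitPlane)
    (hy : y = 0 ∨ y ∈ Complex.slitPlane) (hz : z ∈ Complex.slitPlane) :
    AEStronglyMeasurable (rdIntegrand x y z) (volume.restrict (Set.Ioi 0)) :=
  (continuousOn_rdIntegrand hx hy hz).aestronglyMeasurable measurableSet_Ioi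

/-- With √x = a + ib, |t+x|² = (t-b²)² + 2ta² + 2a²b² + a⁴ ≥ a²(t+a²). -/
lemma le_norm_ofReal_add_sq {x : ℂ} {δ t : ℝ} (hδ : 0 ≤ δ) (hx : δ ≤ x.sqrt.re) (ht : 0 ≤ t) :
    δ ^ 2 * (t + δ ^ 2) ≤ ‖(t : ℂ) + x‖ ^ 2 := by
  have e : ‖(t : ℂ) + x‖ ^ 2 = (t + (x.sqrt.re ^ 2 - x.sqrt.im ^ 2)) ^ 2 +
      (2 * (x.sqrt.re * x.sqrt.im)) ^ 2 := by
    have h2 := congrArg Complex.im (sqrt_sq x)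
    simp only [sq, Complex.mul_im] at h2
    rw [re_sq_eq, Complex.sq_norm, Complex.normSq_apply]
    simp only [Complex.add_re, Complex.ofReal_re, Complex.add_im, Complex.ofReal_im, ← h2]
    ring
  rw [e]
  have h1 : δ ^ 2 ≤ x.sqrt.re ^ 2 := pow_le_pow_left₀ hδ hx 2
  calc δ ^ 2 * (t + δ ^ 2) ≤ x.sqrt.re ^ 2 * (t + x.sqrt.re ^ 2) := by gcongr
    _ ≤ _ := by
      nlinarith [sq_nonneg (t - x.sqrt.im ^ 2), mul_nonneg ht (sq_nonneg x.sqrt.re),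
        mul_nonneg (sq_nonneg x.sqrt.re) (sq_nonneg x.sqrt.im)]

lemma le_norm_sqrt_ofReal_add {x : ℂ} {δ t : ℝ} (hδ : 0 ≤ δ) (hx : δ ≤ x.sqrt.re) (ht : 0 ≤ t) :
    (δ ^ 2 * (t + δ ^ 2)) ^ (1 / 4 : ℝ) ≤ ‖((t : ℂ) + x).sqrt‖ := by
  refine le_of_pow_le_pow_left₀ (n := 4) (by norm_num) (norm_nonneg _) ?_
  rw [← Real.rpow_natCast, ← Real.rpow_mul (by positivity)]
  norm_num
  calc _ ≤ _ := le_norm_ofReal_add_sq hδ hx ht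
    _ = _ := by rw [← norm_sqrt_sq]; ring

/-- The denominator is a product of five square roots, each at least (δ²(t+δ²))^{1/4}; hence the
exponent 5/4, which exceeds 1 and makes the bound integrable. -/
lemma norm_rdIntegrand_le {x y z : ℂ} {δ t : ℝ} (hδ : 0 < δ) (hx : δ ≤ x.sqrt.re)
    (hy : δ ≤ y.sqrt.re) (hz : δ ≤ z.sqrt.re) (ht : 0 ≤ t) :
    ‖rdIntegrand x y z t‖ ≤ (δ ^ 2) ^ (-(5 / 4) : ℝ) * (t + δ ^ 2) ^ (-(5 / 4) : ℝ) := by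
  have hM : 0 < δ ^ 2 * (t + δ ^ 2) := by positivity
  set M := δ ^ 2 * (t + δ ^ 2) with hMdef
  have e : (δ ^ 2) ^ (-(5 / 4) : ℝ) * (t + δ ^ 2) ^ (-(5 / 4) : ℝ) =
      (M ^ (1 / 4 : ℝ) * M ^ (1 / 4 : ℝ) * (M ^ (1 / 4 : ℝ)) ^ 3)⁻¹ := by
    rw [← Real.mul_rpow (by positivity) (by positivity), ← hMdef, ← Real.rpow_add hM,
      ← Real.rpow_natCast, ← Real.rpow_mul hM.le, ← Real.rpow_add hM, ← Real.rpow_neg hM.le]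
    norm_num
  rw [e, rdIntegrand_eq, norm_inv, norm_mul, norm_mul, norm_pow]
  have h4 : 0 < M ^ (1 / 4 : ℝ) := by positivity
  have := le_norm_sqrt_ofReal_add hδ.le hx ht
  have := le_norm_sqrt_ofReal_add hδ.le hy ht
  have := le_norm_sqrt_ofReal_add hδ.le hz ht
  gcongr

lemma integral_add_rpow_Ioi {a m : ℝ} (ha : a < -1) (hm : 0 < m) :
    ∫ t in Set.Ioi (0 : ℝ), (t + m) ^ a = -m ^ (a + 1) / (a + 1) := by
  have hd : ∀ x ∈ Set.Ici (0 : ℝ),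
      HasDerivAt (fun t : ℝ ↦ (t + m) ^ (a + 1) / (a + 1)) ((x + m) ^ a) x := by
    intro x hx
    have hx' : (0 : ℝ) ≤ x := hx
    have h1 := (((hasDerivAt_id x).add_const m).rpow_const (p := a + 1)
      (Or.inl (by simp only [id]; linarith))).div_const (a + 1)
    refine h1.congr_deriv ?_
    have : a + 1 ≠ 0 := by linarith
    simp only [id, add_sub_cancel_right]
    field_simp
  have ht : Tendsto (fun t : ℝ ↦ ((t + m) ^ (a + 1)) / (a + 1)) atTop (nhds (0 / (a + 1))) := by
    rw [← neg_neg (a + 1)]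
    exact ((tendsto_rpow_neg_atTop (by linarith)).comp
      (tendsto_atTop_add_const_right _ m tendsto_id)).div_const _
  rw [integral_Ioi_of_hasDerivAt_of_tendsto' hd
    (integrableOn_add_rpow_Ioi_of_lt ha (by linarith)) ht]
  simp only [zero_add]
  ring

lemma integrableOn_rdIntegrand_of_le_re_sqrt {x y z : ℂ} {δ : ℝ} (hδ : 0 < δ)
    (hx : δ ≤ x.sqrt.re) (hy : δ ≤ y.sqrt.re) (hz : δ ≤ z.sqrt.re) :
    IntegrableOn (rdIntegrand x y z) (Set.Ioi 0) := by
  refine Integrable.mono' (g := fun t => (δ ^ 2) ^ (-(5 / 4) : ℝ) * (t + δ ^ 2) ^ (-(5 / 4) : ℝ))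
    ((integrableOn_add_rpow_Ioi_of_lt (by norm_num) (by simp; positivity)).const_mul _) ?_ ?_
  · exact aestronglyMeasurable_rdIntegrand
      (Or.inr (mem_slitPlane_of_sqrt_re_pos (hδ.trans_le hx)))
      (Or.inr (mem_slitPlane_of_sqrt_re_pos (hδ.trans_le hy)))
      (mem_slitPlane_of_sqrt_re_pos (hδ.trans_le hz))
  · filter_upwards [ae_restrict_mem measurableSet_Ioi] with t ht
    exact norm_rdIntegrand_le hδ hx hy hz (le_of_lt ht)

lemma norm_RD_le {x y z : ℂ} {δ : ℝ} (hδ : 0 < δ) (hx : δ ≤ x.sqrt.re)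
    (hy : δ ≤ y.sqrt.re) (hz : δ ≤ z.sqrt.re) : ‖RD x y z‖ ≤ 6 * (δ ^ 3)⁻¹ := by
  have h1 : ‖∫ t in Set.Ioi (0 : ℝ), rdIntegrand x y z t‖ ≤
      ∫ t in Set.Ioi (0 : ℝ), (δ ^ 2) ^ (-(5 / 4) : ℝ) * (t + δ ^ 2) ^ (-(5 / 4) : ℝ) := by
    refine norm_integral_le_of_norm_le
      ((integrableOn_add_rpow_Ioi_of_lt (by norm_num) (by simp; positivity)).const_mul _) ?_
    filter_upwards [ae_restrict_mem measurableSet_Ioi] with t ht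
    exact norm_rdIntegrand_le hδ hx hy hz (le_of_lt ht)
  rw [integral_const_mul, integral_add_rpow_Ioi (by norm_num) (by positivity)] at h1
  have e : (δ ^ 2) ^ (-(5 / 4) : ℝ) *
      (-(δ ^ 2) ^ (-(5 / 4) + 1 : ℝ) / (-(5 / 4) + 1)) = 4 * (δ ^ 3)⁻¹ := by
    have : (δ ^ 3)⁻¹ = (δ ^ 2) ^ (-(5 / 4) : ℝ) * (δ ^ 2) ^ (-(5 / 4) + 1 : ℝ) := by
      rw [← Real.rpow_add (by positivity), ← Real.rpow_natCast, ← Real.rpow_natCast,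
        ← Real.rpow_mul hδ.le, ← Real.rpow_neg hδ.le]
      norm_num
    rw [this]; ring
  rw [e] at h1
  rw [RD, norm_mul]
  have : ‖(3 / 2 : ℂ)‖ = 3 / 2 := by norm_num
  rw [this]; linarith

lemma exists_le_re_sqrt {x y z : ℂ} (hx : x ∈ Complex.slitPlane) (hy : y ∈ Complex.slitPlane)
    (hz : z ∈ Complex.slitPlane) :
    ∃ δ : ℝ, 0 < δ ∧ δ ≤ x.sqrt.re ∧ δ ≤ y.sqrt.re ∧ δ ≤ z.sqrt.re :=
  ⟨min x.sqrt.re (min y.sqrt.re z.sqrt.re),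
    lt_min (sqrt_re_pos hx) (lt_min (sqrt_re_pos hy) (sqrt_re_pos hz)), min_le_left _ _,
    (min_le_right _ _).trans (min_le_left _ _), (min_le_right _ _).trans (min_le_right _ _)⟩

/-- The root √t is kept exact and the other four roots supply δ²(t+δ²). The result is an integrable
t^{-1/2} singularity at 0 and t^{-3/2} decay at infinity, whence the split at t = 1. -/
lemma integrableOn_rdIntegrand_zero_left {y z : ℂ} (hy : y ∈ Complex.slitPlane)
    (hz : z ∈ Complex.slitPlane) : IntegrableOn (rdIntegrand 0 y z) (Set.Ioi 0) := by
  obtain ⟨δ, hδ, -, hy', hz'⟩ := exists_le_re_sqrt hy hy hz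
  have hmeas := aestronglyMeasurable_rdIntegrand (Or.inl rfl) (Or.inr hy) hz
  have key : ∀ t : ℝ, 0 < t → ‖rdIntegrand 0 y z t‖ ≤ (δ ^ 2)⁻¹ * (t + δ ^ 2)⁻¹ * (√t)⁻¹ := by
    intro t ht
    have hM : 0 < δ ^ 2 * (t + δ ^ 2) := by positivity
    have h1 := le_norm_sqrt_ofReal_add hδ.le hy' ht.le
    have h2 := le_norm_sqrt_ofReal_add hδ.le hz' ht.le
    set M := δ ^ 2 * (t + δ ^ 2) with hMdef
    have e : (δ ^ 2)⁻¹ * (t + δ ^ 2)⁻¹ * (√t)⁻¹ =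
        (√t * M ^ (1 / 4 : ℝ) * (M ^ (1 / 4 : ℝ)) ^ 3)⁻¹ := by
      have e4 : M ^ (1 / 4 : ℝ) * (M ^ (1 / 4 : ℝ)) ^ 3 = M := by
        rw [← pow_succ', ← Real.rpow_natCast, ← Real.rpow_mul hM.le]
        norm_num
      rw [mul_assoc √t, e4, mul_inv, hMdef, mul_inv]
      ring
    rw [e, rdIntegrand_eq, norm_inv, norm_mul, norm_mul, norm_pow, add_zero, sqrt_ofReal ht,
      Complex.norm_of_nonneg (Real.sqrt_nonneg _)]
    have h4 : 0 < M ^ (1 / 4 : ℝ) := by positivity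
    have h5 : 0 < √t := Real.sqrt_pos.2 ht
    gcongr
  rw [← Set.Ioc_union_Ioi_eq_Ioi (zero_le_one (α := ℝ)), integrableOn_union]
  constructor
  · refine Integrable.mono' (g := fun t => (δ ^ 2)⁻¹ * (δ ^ 2)⁻¹ * t ^ (-(1 / 2) : ℝ)) ?_
      (hmeas.mono_measure (Measure.restrict_mono_set _ Set.Ioc_subset_Ioi_self)) ?_
    · have := (intervalIntegral.intervalIntegrable_rpow' (a := 0) (b := 1) (r := -(1 / 2))
        (by norm_num)).const_mul ((δ ^ 2)⁻¹ * (δ ^ 2)⁻¹)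
      rwa [intervalIntegrable_iff_integrableOn_Ioc_of_le zero_le_one] at this
    · filter_upwards [ae_restrict_mem measurableSet_Ioc] with t ht
      have ht0 : 0 < t := ht.1
      rw [Real.rpow_neg ht0.le, ← Real.sqrt_eq_rpow]
      refine (key t ht0).trans ?_
      gcongr
      linarith
  · refine Integrable.mono' (g := fun t => (δ ^ 2)⁻¹ * t ^ (-(3 / 2) : ℝ))
      ((integrableOn_Ioi_rpow_of_lt (by norm_num) one_pos).const_mul _)
      (hmeas.mono_measure (Measure.restrict_mono_set _ (Set.Ioi_subset_Ioi zero_le_one))) ?_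
    filter_upwards [ae_restrict_mem measurableSet_Ioi] with t ht
    have ht0 : 0 < t := lt_trans one_pos ht
    have e : t ^ (-(3 / 2) : ℝ) = t⁻¹ * (√t)⁻¹ := by
      rw [Real.sqrt_eq_rpow, ← Real.rpow_neg ht0.le, ← Real.rpow_neg_one, ← Real.rpow_add ht0]
      norm_num
    rw [e, ← mul_assoc]
    refine (key t ht0).trans ?_
    have : 0 < δ ^ 2 := by positivity
    gcongr
    linarith

lemma integrableOn_rdIntegrand {x y z : ℂ} (h : Admissible x y z) :
    IntegrableOn (rdIntegrand x y z) (Set.Ioi 0) := by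
  obtain ⟨hx | hx, hy | hy, hz, hxy⟩ := h
  · exact absurd ⟨hx, hy⟩ hxy
  · subst hx
    exact integrableOn_rdIntegrand_zero_left hy hz
  · subst hy
    rw [show rdIntegrand x 0 z = rdIntegrand 0 x z from funext (rdIntegrand_comm x 0 z)]
    exact integrableOn_rdIntegrand_zero_left hx hz
  · obtain ⟨δ, hδ, h1, h2, h3⟩ := exists_le_re_sqrt hx hy hz
    exact integrableOn_rdIntegrand_of_le_re_sqrt hδ h1 h2 h3

/-! ### The derivative of R_D along the diagonal -/

/-- The integrand of `R_D` as a function of a complex integration variable. -/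
noncomputable def kernel (x y z w : ℂ) : ℂ :=
  ((w + x).sqrt * (w + y).sqrt * (w + z).sqrt ^ 3)⁻¹

lemma rdIntegrand_add (x y z ζ : ℂ) (t : ℝ) :
    rdIntegrand (x + ζ) (y + ζ) (z + ζ) t = kernel x y z (t + ζ) := by
  rw [rdIntegrand_eq, kernel]
  simp only [add_assoc, add_comm ζ]

lemma rdIntegrand_eq_kernel (x y z : ℂ) (t : ℝ) : rdIntegrand x y z t = kernel x y z t := by
  rw [rdIntegrand_eq, kernel]

/-- The derivative of `kernel` with respect to its last variable. -/
noncomputable def dkernel (x y z w : ℂ) : ℂ :=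
  -(kernel x y z w * ((w + x)⁻¹ / 2 + (w + y)⁻¹ / 2 + 3 * (w + z)⁻¹ / 2))

lemma hasDerivAt_kernel {x y z w : ℂ} (hx : w + x ∈ Complex.slitPlane)
    (hy : w + y ∈ Complex.slitPlane) (hz : w + z ∈ Complex.slitPlane) :
    HasDerivAt (kernel x y z) (dkernel x y z w) w := by
  have h : ∀ u : ℂ, w + u ∈ Complex.slitPlane →
      HasDerivAt (fun v : ℂ => (v + u).sqrt) (1 / (2 * (w + u).sqrt)) w := fun u hu => by
    exact (hasDerivAt_sqrt hu).comp_add_const w u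
  have nx := sqrt_ne_zero hx
  have ny := sqrt_ne_zero hy
  have nz := sqrt_ne_zero hz
  have h1 := (((h x hx).mul (h y hy)).mul ((h z hz).pow 3)).inv
    (mul_ne_zero (mul_ne_zero nx ny) (pow_ne_zero 3 nz))
  refine h1.congr_deriv ?_
  simp only [dkernel, kernel, Pi.mul_apply, Pi.pow_apply]
  generalize hgx : w + x = a at *
  generalize hgy : w + y = b at *
  generalize hgz : w + z = c at *
  have ea := sqrt_sq a
  have eb := sqrt_sq b
  have ec := sqrt_sq c
  rw [show a⁻¹ = (a.sqrt ^ 2)⁻¹ by rw [ea], show b⁻¹ = (b.sqrt ^ 2)⁻¹ by rw [eb],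
    show c⁻¹ = (c.sqrt ^ 2)⁻¹ by rw [ec]]
  field_simp
  push_cast
  ring

lemma norm_inv_ofReal_add_le {x : ℂ} {δ t : ℝ} (hδ : 0 < δ) (hx : δ ≤ x.sqrt.re) (ht : 0 ≤ t) :
    ‖((t : ℂ) + x)⁻¹‖ ≤ (δ ^ 2)⁻¹ := by
  rw [norm_inv]
  refine inv_anti₀ (by positivity) ?_
  refine le_of_sq_le_sq (a := δ ^ 2) ?_ (norm_nonneg _)
  refine le_trans ?_ (le_norm_ofReal_add_sq hδ.le hx ht)
  nlinarith [sq_nonneg δ, mul_nonneg ht (sq_nonneg δ)]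

lemma norm_dkernel_le {x y z : ℂ} {δ t : ℝ} (hδ : 0 < δ) (hx : δ ≤ x.sqrt.re)
    (hy : δ ≤ y.sqrt.re) (hz : δ ≤ z.sqrt.re) (ht : 0 ≤ t) :
    ‖dkernel x y z t‖ ≤ ((δ ^ 2) ^ (-(5 / 4) : ℝ) * (t + δ ^ 2) ^ (-(5 / 4) : ℝ)) *
      (5 / 2 * (δ ^ 2)⁻¹) := by
  rw [dkernel, norm_neg, norm_mul, ← rdIntegrand_eq_kernel]
  gcongr
  · exact norm_rdIntegrand_le hδ hx hy hz ht
  · have h1 := norm_inv_ofReal_add_le hδ hx ht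
    have h2 := norm_inv_ofReal_add_le hδ hy ht
    have h3 := norm_inv_ofReal_add_le hδ hz ht
    refine (norm_add₃_le).trans ?_
    simp only [norm_div, norm_mul]
    norm_num
    rw [norm_inv] at h1 h2 h3
    linarith

lemma tendsto_rpow_bound {C m : ℝ} :
    Tendsto (fun t : ℝ => C * (t + m) ^ (-(5 / 4) : ℝ)) atTop (nhds 0) := by
  have := ((tendsto_rpow_neg_atTop (y := 5 / 4) (by norm_num)).comp
    (tendsto_atTop_add_const_right _ m tendsto_id)).const_mul C
  simpa using this

lemma dkernel_eq_add (x y z ζ : ℂ) (t : ℝ) :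
    dkernel x y z (t + ζ) = dkernel (x + ζ) (y + ζ) (z + ζ) t := by
  simp only [dkernel, kernel, add_assoc, add_comm ζ]

/-- Along the diagonal direction, the derivative of `R_D` is `-3/2` times its integrand at `0`. -/
lemma hasDerivAt_RD_add {x y z : ℂ} (hx : x ∈ Complex.slitPlane) (hy : y ∈ Complex.slitPlane)
    (hz : z ∈ Complex.slitPlane) :
    HasDerivAt (fun ζ : ℂ => RD (x + ζ) (y + ζ) (z + ζ))
      (-(3 / 2) * (x.sqrt * y.sqrt * z.sqrt ^ 3)⁻¹) 0 := by
  obtain ⟨δ, hδ, hx', hy', hz'⟩ := exists_le_re_sqrt hx hy hz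
  have hδ2 : 0 < δ / 2 := by positivity
  have hev : ∀ u : ℂ, u ∈ Complex.slitPlane → δ ≤ u.sqrt.re →
      ∀ᶠ ζ : ℂ in nhds 0, δ / 2 ≤ (u + ζ).sqrt.re := by
    intro u hu hδu
    have hc : ContinuousAt (fun ζ : ℂ => (u + ζ).sqrt.re) 0 := by
      refine Complex.continuous_re.continuousAt.comp ?_
      refine ContinuousAt.comp (f := fun ζ : ℂ => u + ζ) (g := Complex.sqrt) ?_ (by fun_prop)
      simpa using continuousAt_sqrt (Or.inr hu)
    have : δ / 2 < (u + 0).sqrt.re := by rw [add_zero]; linarith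
    exact (hc.eventually_const_lt this).mono fun _ h => h.le
  -- Near ζ = 0 the roots keep real part at least δ/2, so one dominating function serves for all
  -- these ζ.
  have hs := ((hev x hx hx').and ((hev y hy hy').and (hev z hz hz')))
  have hslit : ∀ u ζ : ℂ, ∀ t : ℝ, 0 < t → δ / 2 ≤ (u + ζ).sqrt.re →
      (t : ℂ) + ζ + u ∈ Complex.slitPlane := by
    intro u ζ t ht h
    rw [add_assoc, add_comm ζ]
    exact ofReal_add_mem_slitPlane (Or.inr (mem_slitPlane_of_sqrt_re_pos (hδ2.trans_le h))) ht
  have hdker : ∀ t : ℝ, 0 < t → HasDerivAt (fun t : ℝ => kernel x y z t) (dkernel x y z t) t := by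
    intro t ht
    exact (hasDerivAt_kernel (ofReal_add_mem_slitPlane (Or.inr hx) ht)
      (ofReal_add_mem_slitPlane (Or.inr hy) ht)
      (ofReal_add_mem_slitPlane (Or.inr hz) ht)).comp_ofReal
  have hcont : ContinuousWithinAt (fun t : ℝ => kernel x y z t) (Set.Ici 0) 0 := by
    have h1 : ContinuousAt (kernel x y z) ((0 : ℝ) : ℂ) := by
      refine (hasDerivAt_kernel ?_ ?_ ?_).continuousAt <;> simpa
    exact (ContinuousAt.comp (f := Complex.ofReal) h1
      Complex.continuous_ofReal.continuousAt).continuousWithinAt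
  have hmain := hasDerivAt_integral_of_dominated_loc_of_deriv_le
    (μ := volume.restrict (Set.Ioi (0 : ℝ))) (𝕜 := ℂ)
    (F := fun ζ t => rdIntegrand (x + ζ) (y + ζ) (z + ζ) t)
    (F' := fun ζ t => dkernel x y z (t + ζ)) (x₀ := 0)
    (bound := fun t => (((δ / 2) ^ 2) ^ (-(5 / 4) : ℝ) * (t + (δ / 2) ^ 2) ^ (-(5 / 4) : ℝ)) *
      (5 / 2 * ((δ / 2) ^ 2)⁻¹)) hs ?_ ?_ ?_ ?_ ?_ ?_
  · have hint : ∫ t in Set.Ioi (0 : ℝ), dkernel x y z t = 0 - kernel x y z (0 : ℝ) := by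
      refine integral_Ioi_of_hasDerivAt_of_tendsto (f := fun t : ℝ => kernel x y z t)
        hcont hdker ?_ ?_
      · simpa [IntegrableOn] using hmain.1
      · refine squeeze_zero_norm' ?_ (tendsto_rpow_bound (C := (δ ^ 2) ^ (-(5 / 4) : ℝ))
          (m := δ ^ 2))
        filter_upwards [eventually_ge_atTop 0] with t ht
        rw [← rdIntegrand_eq_kernel]
        exact norm_rdIntegrand_le hδ hx' hy' hz' ht
    have h2 := hmain.2.const_mul (3 / 2 : ℂ)
    simp only [add_zero] at h2
    rw [hint] at h2
    refine h2.congr_deriv ?_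
    simp only [kernel, Complex.ofReal_zero, zero_add]
    ring
  · filter_upwards [hs] with ζ hζ
    exact aestronglyMeasurable_rdIntegrand
      (Or.inr (mem_slitPlane_of_sqrt_re_pos (hδ2.trans_le hζ.1)))
      (Or.inr (mem_slitPlane_of_sqrt_re_pos (hδ2.trans_le hζ.2.1)))
      (mem_slitPlane_of_sqrt_re_pos (hδ2.trans_le hζ.2.2))
  · simp only [add_zero]
    exact integrableOn_rdIntegrand_of_le_re_sqrt hδ hx' hy' hz'
  · refine (aestronglyMeasurable_derivWithin_Ioi (F := ℂ) (fun t : ℝ => kernel x y z t) _).congr ?_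
    filter_upwards [ae_restrict_mem measurableSet_Ioi] with t ht
    rw [add_zero, (hdker t ht).hasDerivWithinAt.derivWithin (uniqueDiffWithinAt_Ioi t)]
  · filter_upwards [ae_restrict_mem measurableSet_Ioi] with t ht ζ hζ
    rw [dkernel_eq_add]
    exact norm_dkernel_le hδ2 hζ.1 hζ.2.1 hζ.2.2 (le_of_lt ht)
  · exact ((integrableOn_add_rpow_Ioi_of_lt (by norm_num)
      (by simp; positivity)).const_mul _).mul_const _
  · filter_upwards [ae_restrict_mem measurableSet_Ioi] with t ht ζ hζ
    simp only [rdIntegrand_add]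
    exact (hasDerivAt_kernel (hslit x ζ t ht hζ.1) (hslit y ζ t ht hζ.2.1)
      (hslit z ζ t ht hζ.2.2)).comp_const_add (t : ℂ) ζ

/-! ### The duplication formula -/

lemma step_fst (x y z : ℂ) :
    (x + lam x y z) / 4 = (x.sqrt + y.sqrt) / 2 * ((x.sqrt + z.sqrt) / 2) := by
  have := sqrt_sq x
  rw [lam]; linear_combination -(1 / 4) * this

lemma step_snd (x y z : ℂ) :
    (y + lam x y z) / 4 = (x.sqrt + y.sqrt) / 2 * ((y.sqrt + z.sqrt) / 2) := by
  have := sqrt_sq y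
  rw [lam]; linear_combination -(1 / 4) * this

lemma step_trd (x y z : ℂ) :
    (z + lam x y z) / 4 = (x.sqrt + z.sqrt) / 2 * ((y.sqrt + z.sqrt) / 2) := by
  have := sqrt_sq z
  rw [lam]; linear_combination -(1 / 4) * this

lemma re_half_add_sqrt (x y : ℂ) :
    ((x.sqrt + y.sqrt) / 2).re = (x.sqrt.re + y.sqrt.re) / 2 := by
  rw [show (2 : ℂ) = ((2 : ℝ) : ℂ) by norm_num, Complex.div_ofReal_re, Complex.add_re]

lemma re_half_add_sqrt_pos {x y : ℂ} (hx : x = 0 ∨ x ∈ Complex.slitPlane)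
    (hy : y = 0 ∨ y ∈ Complex.slitPlane) (h : ¬ (x = 0 ∧ y = 0)) :
    0 < ((x.sqrt + y.sqrt) / 2).re := by
  rw [re_half_add_sqrt]
  rcases hx with hx | hx
  · rcases hy with hy | hy
    · exact absurd ⟨hx, hy⟩ h
    · linarith [sqrt_re_nonneg x, sqrt_re_pos hy]
  · linarith [sqrt_re_nonneg y, sqrt_re_pos hx]

lemma Admissible.re_pos {x y z : ℂ} (h : Admissible x y z) :
    0 < ((x.sqrt + y.sqrt) / 2).re ∧ 0 < ((x.sqrt + z.sqrt) / 2).re ∧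
      0 < ((y.sqrt + z.sqrt) / 2).re := by
  obtain ⟨hx, hy, hz, hxy⟩ := h
  have hz0 : z ≠ 0 := fun h => Complex.zero_notMem_slitPlane (h ▸ hz)
  exact ⟨re_half_add_sqrt_pos hx hy hxy,
    re_half_add_sqrt_pos hx (Or.inr hz) fun h => hz0 h.2,
    re_half_add_sqrt_pos hy (Or.inr hz) fun h => hz0 h.2⟩

lemma Admissible.step_mem {x y z : ℂ} (h : Admissible x y z) :
    (x + lam x y z) / 4 ∈ Complex.slitPlane ∧ (y + lam x y z) / 4 ∈ Complex.slitPlane ∧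
      (z + lam x y z) / 4 ∈ Complex.slitPlane := by
  obtain ⟨h1, h2, h3⟩ := h.re_pos
  rw [step_fst, step_snd, step_trd]
  exact ⟨mul_mem_slitPlane h1 h2, mul_mem_slitPlane h1 h3, mul_mem_slitPlane h2 h3⟩

lemma admissible_of_mem {x y z : ℂ} (hx : x ∈ Complex.slitPlane) (hy : y ∈ Complex.slitPlane)
    (hz : z ∈ Complex.slitPlane) : Admissible x y z :=
  ⟨Or.inr hx, Or.inr hy, hz, fun h => Complex.zero_notMem_slitPlane (h.1 ▸ hx)⟩

lemma Admissible.add_ofReal {x y z : ℂ} (h : Admissible x y z) {t : ℝ} (ht : 0 < t) :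
    x + t ∈ Complex.slitPlane ∧ y + t ∈ Complex.slitPlane ∧ z + t ∈ Complex.slitPlane := by
  rw [add_comm x, add_comm y, add_comm z]
  exact ⟨ofReal_add_mem_slitPlane h.1 ht, ofReal_add_mem_slitPlane h.2.1 ht,
    ofReal_add_mem_slitPlane (Or.inr h.2.2.1) ht⟩

/-- Each new root is √p √q with p, q averages of two old roots. Averaging preserves the bound δ, and
so does taking √p √q. -/
lemma le_re_sqrt_step {x y z : ℂ} {δ : ℝ} (hδ : 0 < δ) (hx : δ ≤ x.sqrt.re)
    (hy : δ ≤ y.sqrt.re) (hz : δ ≤ z.sqrt.re) :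
    δ ≤ ((x + lam x y z) / 4).sqrt.re ∧ δ ≤ ((y + lam x y z) / 4).sqrt.re ∧
      δ ≤ ((z + lam x y z) / 4).sqrt.re := by
  have h1 : δ ≤ ((x.sqrt + y.sqrt) / 2).re := by rw [re_half_add_sqrt]; linarith
  have h2 : δ ≤ ((x.sqrt + z.sqrt) / 2).re := by rw [re_half_add_sqrt]; linarith
  have h3 : δ ≤ ((y.sqrt + z.sqrt) / 2).re := by rw [re_half_add_sqrt]; linarith
  rw [step_fst, step_snd, step_trd, sqrt_mul_of_re_pos (by linarith) (by linarith),
    sqrt_mul_of_re_pos (by linarith) (by linarith), sqrt_mul_of_re_pos (by linarith) (by linarith)]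
  exact ⟨le_re_sqrt_mul_sqrt hδ h1 h2, le_re_sqrt_mul_sqrt hδ h1 h3, le_re_sqrt_mul_sqrt hδ h2 h3⟩

/-- The right-hand side of the duplication formula for `R_D`. -/
noncomputable def duplicated (x y z : ℂ) : ℂ :=
  4⁻¹ * RD ((x + lam x y z) / 4) ((y + lam x y z) / 4) ((z + lam x y z) / 4) +
    3 * (z.sqrt * (z + lam x y z))⁻¹

lemma Admissible.sqrt_mul_add_lam_ne_zero {x y z : ℂ} (h : Admissible x y z) :
    z.sqrt * (z + lam x y z) ≠ 0 := by
  refine mul_ne_zero (sqrt_ne_zero h.2.2.1) fun h0 => ?_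
  have := h.step_mem.2.2
  rw [h0, zero_div] at this
  exact Complex.zero_notMem_slitPlane this

lemma hasDerivAt_duplicated {x y z : ℂ} (hx : x ∈ Complex.slitPlane) (hy : y ∈ Complex.slitPlane)
    (hz : z ∈ Complex.slitPlane) :
    HasDerivAt (fun ζ : ℂ => duplicated (x + ζ) (y + ζ) (z + ζ))
      (-(3 / 2) * (x.sqrt * y.sqrt * z.sqrt ^ 3)⁻¹) 0 := by
  have hadm := admissible_of_mem hx hy hz
  obtain ⟨p1, p2, p3⟩ := hadm.re_pos
  obtain ⟨q1, q2, q3⟩ := hadm.step_mem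
  have hs : ∀ u : ℂ, u ∈ Complex.slitPlane →
      HasDerivAt (fun ζ : ℂ => (u + ζ).sqrt) (1 / (2 * u.sqrt)) 0 := fun u hu =>
    HasDerivAt.comp_const_add u 0 (by simpa only [add_zero] using hasDerivAt_sqrt hu)
  have hlam : HasDerivAt (fun ζ : ℂ => lam (x + ζ) (y + ζ) (z + ζ))
      ((1 / (2 * x.sqrt) * y.sqrt + x.sqrt * (1 / (2 * y.sqrt))) +
        (1 / (2 * x.sqrt) * z.sqrt + x.sqrt * (1 / (2 * z.sqrt))) +
        (1 / (2 * y.sqrt) * z.sqrt + y.sqrt * (1 / (2 * z.sqrt)))) 0 := by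
    have := (((hs x hx).mul (hs y hy)).add ((hs x hx).mul (hs z hz))).add
      ((hs y hy).mul (hs z hz))
    simp only [add_zero] at this
    exact this
  have hσ := (((hasDerivAt_id (0 : ℂ)).add hlam).sub_const (lam x y z)).div_const 4
  have hRD := hasDerivAt_RD_add q1 q2 q3
  have hcomp := HasDerivAt.comp_of_eq (0 : ℂ) hRD hσ (by simp)
  have hden := ((hs z hz).mul (((hasDerivAt_id (0 : ℂ)).const_add z).add hlam)).inv
    (by simpa using hadm.sqrt_mul_add_lam_ne_zero)
  have h := (hcomp.const_mul 4⁻¹).add (hden.const_mul 3)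
  -- Shifting x, y, z by ζ moves the three new variables by one common amount, so the chain rule
  -- applies to the diagonal derivative of R_D.
  have e : ∀ u ζ : ℂ, (u + ζ + lam (x + ζ) (y + ζ) (z + ζ)) / 4 = (u + lam x y z) / 4 +
      (ζ + lam (x + ζ) (y + ζ) (z + ζ) - lam x y z) / 4 := fun u ζ => by ring
  have hfun : (fun ζ : ℂ => duplicated (x + ζ) (y + ζ) (z + ζ)) =
      fun ζ => 4⁻¹ * RD ((x + lam x y z) / 4 + (ζ + lam (x + ζ) (y + ζ) (z + ζ) - lam x y z) / 4)
        ((y + lam x y z) / 4 + (ζ + lam (x + ζ) (y + ζ) (z + ζ) - lam x y z) / 4)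
        ((z + lam x y z) / 4 + (ζ + lam (x + ζ) (y + ζ) (z + ζ) - lam x y z) / 4) +
      3 * ((z + ζ).sqrt * (z + ζ + lam (x + ζ) (y + ζ) (z + ζ)))⁻¹ := by
    funext ζ
    rw [duplicated, e, e, e]
  rw [hfun]
  refine HasDerivAt.congr_deriv h ?_
  have hne : ∀ w : ℂ, 0 < (w / 2).re → w ≠ 0 := fun w hw h0 => by simp [h0] at hw
  have n1 := hne _ p1
  have n2 := hne _ p2
  have n3 := hne _ p3
  have na := sqrt_ne_zero hx
  have nb := sqrt_ne_zero hy
  have nc := sqrt_ne_zero hz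
  have eRD : ((x + lam x y z) / 4).sqrt * ((y + lam x y z) / 4).sqrt *
      ((z + lam x y z) / 4).sqrt ^ 3 = (x.sqrt + y.sqrt) / 2 * ((x.sqrt + z.sqrt) / 2) ^ 2 *
        ((y.sqrt + z.sqrt) / 2) ^ 2 := by
    rw [step_fst, step_snd, step_trd, sqrt_mul_of_re_pos p1 p2, sqrt_mul_of_re_pos p1 p3,
      sqrt_mul_of_re_pos p2 p3]
    have f1 := sqrt_sq ((x.sqrt + y.sqrt) / 2)
    have f2 := sqrt_sq ((x.sqrt + z.sqrt) / 2)
    have f3 := sqrt_sq ((y.sqrt + z.sqrt) / 2)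
    conv_rhs => rw [← f1, ← f2, ← f3]
    ring
  rw [eRD]
  have ez : z + lam x y z = (x.sqrt + z.sqrt) * (y.sqrt + z.sqrt) := by
    linear_combination 4 * step_trd x y z
  simp only [Pi.mul_apply, Pi.add_apply, id, add_zero]
  rw [ez]
  -- Everything is now a rational function of √x, √y, √z, and the claim is an identity between such
  -- functions.
  field_simp
  ring

lemma re_le_re_sqrt_sq (w : ℂ) : w.re ≤ w.sqrt.re ^ 2 := by
  have := re_sq_eq w
  nlinarith [sq_nonneg w.sqrt.im]

lemma norm_duplicated_le {x y z : ℂ} {δ : ℝ} (hδ : 0 < δ) (hx : δ ≤ x.sqrt.re)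
    (hy : δ ≤ y.sqrt.re) (hz : δ ≤ z.sqrt.re) : ‖duplicated x y z‖ ≤ 9 * (δ ^ 3)⁻¹ := by
  obtain ⟨h1, h2, h3⟩ := le_re_sqrt_step hδ hx hy hz
  have hRD := norm_RD_le hδ h1 h2 h3
  have hc : δ ≤ ‖z.sqrt‖ := hz.trans (Complex.re_le_norm _)
  have hd : δ ^ 2 ≤ ‖z + lam x y z‖ := by
    have : δ ≤ ‖((z + lam x y z) / 4).sqrt‖ := h3.trans (Complex.re_le_norm _)
    have h4 : δ ^ 2 ≤ ‖(z + lam x y z) / 4‖ := by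
      rw [← norm_sqrt_sq]; gcongr
    rw [norm_div] at h4
    norm_num at h4
    linarith [norm_nonneg (z + lam x y z)]
  have hinv : ‖(z.sqrt * (z + lam x y z))⁻¹‖ ≤ (δ ^ 3)⁻¹ := by
    rw [norm_inv, norm_mul]
    refine inv_anti₀ (by positivity) ?_
    calc δ ^ 3 = δ * δ ^ 2 := by ring
      _ ≤ _ := by gcongr
  rw [duplicated]
  refine (norm_add_le _ _).trans ?_
  rw [norm_mul, norm_mul, norm_inv]
  norm_num
  rw [norm_inv, norm_mul] at hinv
  simp only [mul_inv] at hinv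
  have : 0 ≤ (δ ^ 3)⁻¹ := by positivity
  linarith

/-- The duplication formula for `R_D`. -/
theorem RD_eq_duplicated {x y z : ℂ} (h : Admissible x y z) : RD x y z = duplicated x y z := by
  have hcs : ∀ u : ℂ, u = 0 ∨ u ∈ Complex.slitPlane →
      ContinuousAt (fun t : ℝ => (u + t).sqrt) 0 := by
    intro u hu
    refine ContinuousAt.comp (f := fun t : ℝ => u + t) (g := Complex.sqrt) ?_ (by fun_prop)
    simpa using continuousAt_sqrt hu
  have hclam : ContinuousAt (fun t : ℝ => lam (x + t) (y + t) (z + t)) 0 :=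
    (((hcs x h.1).mul (hcs y h.2.1)).add ((hcs x h.1).mul (hcs z (Or.inr h.2.2.1)))).add
      ((hcs y h.2.1).mul (hcs z (Or.inr h.2.2.1)))
  -- This includes the case x = 0 or y = 0: the duplicated variables are already in the cut plane,
  -- so continuity of R_D at the boundary is not needed.
  have hcont : ContinuousAt (fun t : ℝ => duplicated (x + t) (y + t) (z + t)) 0 := by
    refine ContinuousAt.add (continuousAt_const.mul ?_) (continuousAt_const.mul ?_)
    · obtain ⟨q1, q2, q3⟩ := h.step_mem
      have e : ∀ u : ℂ, ∀ t : ℝ, (u + t + lam (x + t) (y + t) (z + t)) / 4 =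
          (u + lam x y z) / 4 + (t + lam (x + t) (y + t) (z + t) - lam x y z) / 4 :=
        fun u t => by ring
      simp only [e]
      refine ContinuousAt.comp
        (f := fun t : ℝ => (t + lam (x + t) (y + t) (z + t) - lam x y z) / 4)
        (g := fun ζ : ℂ => RD ((x + lam x y z) / 4 + ζ) ((y + lam x y z) / 4 + ζ)
          ((z + lam x y z) / 4 + ζ)) ?_ ?_
      · simpa using (hasDerivAt_RD_add q1 q2 q3).continuousAt
      · exact ((Complex.continuous_ofReal.continuousAt.add hclam).sub
          continuousAt_const).div_const 4
    · refine ContinuousAt.inv₀ ((hcs z (Or.inr h.2.2.1)).mul (ContinuousAt.add ?_ hclam)) ?_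
      · fun_prop
      · simpa using h.sqrt_mul_add_lam_ne_zero
  have hderiv : ∀ t ∈ Set.Ioi (0 : ℝ),
      HasDerivAt (fun t : ℝ => duplicated (x + t) (y + t) (z + t))
        (-(3 / 2) * rdIntegrand x y z t) t := by
    intro t ht
    obtain ⟨h1, h2, h3⟩ := h.add_ofReal ht
    have hd := hasDerivAt_duplicated h1 h2 h3
    have hd' : HasDerivAt (fun w : ℂ => duplicated (x + w) (y + w) (z + w))
        (-(3 / 2) * rdIntegrand x y z t) (t : ℂ) := by
      have := HasDerivAt.comp_of_eq (t : ℂ) hd ((hasDerivAt_id (t : ℂ)).sub_const (t : ℂ)) (by simp)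
      rw [rdIntegrand_eq, add_comm (t : ℂ) x, add_comm (t : ℂ) y, add_comm (t : ℂ) z]
      convert! this using 1
      · funext w
        simp
      · ring
    exact hd'.comp_ofReal
  -- For M below all real parts, every root has real part at least √(t+M), so the value is
  -- O((t+M)^{-3/2}).
  have hlim : Tendsto (fun t : ℝ => duplicated (x + t) (y + t) (z + t)) atTop (nhds 0) := by
    obtain ⟨M, hMx, hMy, hMz⟩ : ∃ M : ℝ, M ≤ x.re ∧ M ≤ y.re ∧ M ≤ z.re :=
      ⟨min x.re (min y.re z.re), min_le_left _ _, (min_le_right _ _).trans (min_le_left _ _),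
        (min_le_right _ _).trans (min_le_right _ _)⟩
    have hs : Tendsto (fun t : ℝ => √(t + M)) atTop atTop :=
      Real.tendsto_sqrt_atTop.comp (tendsto_atTop_add_const_right _ M tendsto_id)
    have hb : Tendsto (fun t : ℝ => 9 * (√(t + M) ^ 3)⁻¹) atTop (nhds 0) := by
      simpa using ((tendsto_inv_atTop_zero.comp
        ((tendsto_pow_atTop (n := 3) (by norm_num)).comp hs)).const_mul 9)
    refine squeeze_zero_norm' ?_ hb
    filter_upwards [eventually_gt_atTop (-M)] with t ht
    have key : ∀ u : ℂ, M ≤ u.re → √(t + M) ≤ (u + t).sqrt.re := by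
      intro u hu
      refine Real.sqrt_le_iff.2 ⟨sqrt_re_nonneg _, le_trans ?_ (re_le_re_sqrt_sq _)⟩
      simp only [Complex.add_re, Complex.ofReal_re]
      linarith
    exact norm_duplicated_le (Real.sqrt_pos.2 (by linarith)) (key x hMx) (key y hMy) (key z hMz)
  have hint := integral_Ioi_of_hasDerivAt_of_tendsto hcont.continuousWithinAt hderiv
    ((integrableOn_rdIntegrand h).const_mul _) hlim
  rw [integral_const_mul] at hint
  simp only [Complex.ofReal_zero, add_zero] at hint
  rw [RD]
  linear_combination -hint

/-! ### Iterated duplication, the stopping criterion and the limit of S_n -/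

lemma xs_zero (x y z : ℂ) : xs x y z 0 = x := rfl
lemma ys_zero (x y z : ℂ) : ys x y z 0 = y := rfl
lemma zs_zero (x y z : ℂ) : zs x y z 0 = z := rfl

lemma xs_succ (x y z : ℂ) (m : ℕ) :
    xs x y z (m + 1) = (xs x y z m + lam (xs x y z m) (ys x y z m) (zs x y z m)) / 4 := rfl
lemma ys_succ (x y z : ℂ) (m : ℕ) :
    ys x y z (m + 1) = (ys x y z m + lam (xs x y z m) (ys x y z m) (zs x y z m)) / 4 := rfl
lemma zs_succ (x y z : ℂ) (m : ℕ) :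
    zs x y z (m + 1) = (zs x y z m + lam (xs x y z m) (ys x y z m) (zs x y z m)) / 4 := rfl
lemma A_succ (x y z : ℂ) (m : ℕ) :
    A x y z (m + 1) = (A x y z m + lam (xs x y z m) (ys x y z m) (zs x y z m)) / 4 := rfl

lemma Admissible.iterate {x y z : ℂ} (h : Admissible x y z) (m : ℕ) :
    Admissible (xs x y z m) (ys x y z m) (zs x y z m) := by
  induction m with
  | zero => exact h
  | succ m ih =>
    rw [xs_succ, ys_succ, zs_succ]
    obtain ⟨h1, h2, h3⟩ := ih.step_mem
    exact admissible_of_mem h1 h2 h3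

theorem RD_eq_iterate {x y z : ℂ} (h : Admissible x y z) (n : ℕ) :
    RD x y z = ((4 : ℂ) ^ n)⁻¹ * RD (xs x y z n) (ys x y z n) (zs x y z n) + sumTerm x y z n := by
  induction n with
  | zero => simp [sumTerm, xs_zero, ys_zero, zs_zero]
  | succ n ih =>
    rw [ih, RD_eq_duplicated (h.iterate n), duplicated, xs_succ, ys_succ, zs_succ, sumTerm, sumTerm,
      Finset.sum_range_succ, lams, pow_succ, mul_inv ((4 : ℂ) ^ n)]
    simp only [div_eq_mul_inv]
    generalize ((zs x y z n).sqrt * (zs x y z n + lam (xs x y z n) (ys x y z n) (zs x y z n)))⁻¹ = d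
    ring

lemma A_eq (x y z : ℂ) (n : ℕ) :
    A x y z n = (xs x y z n + ys x y z n + 3 * zs x y z n) / 5 := by
  induction n with
  | zero => rfl
  | succ n ih => rw [A_succ, ih, xs_succ, ys_succ, zs_succ]; ring

lemma A_sub_xs (x y z : ℂ) (n : ℕ) : A x y z n - xs x y z n = (A x y z 0 - x) / 4 ^ n := by
  induction n with
  | zero => simp [xs_zero]
  | succ n ih => rw [A_succ, xs_succ, pow_succ, ← div_div, ← ih]; ring

lemma A_sub_ys (x y z : ℂ) (n : ℕ) : A x y z n - ys x y z n = (A x y z 0 - y) / 4 ^ n := by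
  induction n with
  | zero => simp [ys_zero]
  | succ n ih => rw [A_succ, ys_succ, pow_succ, ← div_div, ← ih]; ring

/-- The bound starts at index 1 because x or y may be 0, whereas all variables are in the cut plane
after one step. -/
lemma exists_le_re_sqrt_iterate {x y z : ℂ} (h : Admissible x y z) :
    ∃ δ : ℝ, 0 < δ ∧ ∀ n : ℕ, δ ≤ (xs x y z (n + 1)).sqrt.re ∧
      δ ≤ (ys x y z (n + 1)).sqrt.re ∧ δ ≤ (zs x y z (n + 1)).sqrt.re := by
  obtain ⟨h1, h2, h3⟩ := h.step_mem
  obtain ⟨δ, hδ, hx, hy, hz⟩ := exists_le_re_sqrt h1 h2 h3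
  refine ⟨δ, hδ, fun n => ?_⟩
  induction n with
  | zero => exact ⟨hx, hy, hz⟩
  | succ n ih =>
    rw [xs_succ x y z (n + 1), ys_succ x y z (n + 1), zs_succ x y z (n + 1)]
    exact le_re_sqrt_step hδ ih.1 ih.2.1 ih.2.2

lemma tendsto_inv_four_pow : Tendsto (fun n : ℕ => ((4 : ℝ) ^ n)⁻¹) atTop (nhds 0) :=
  tendsto_inv_atTop_zero.comp (tendsto_pow_atTop_atTop_of_one_lt (by norm_num))

/-- |x_n| ≥ δ² for n ≥ 1 and A_n - x_n = 4^{-n}(A_0 - x), so |A_n| is eventually bounded below while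
4^{-n} Q → 0. -/
lemma eventually_stop {x y z : ℂ} (h : Admissible x y z) (r : ℝ) :
    ∀ᶠ n : ℕ in atTop, Stop r x y z n := by
  obtain ⟨δ, hδ, hb⟩ := exists_le_re_sqrt_iterate h
  have hlim : Tendsto (fun n : ℕ => ((4 : ℝ) ^ n)⁻¹ * (Q r x y z + ‖A x y z 0 - x‖)) atTop
      (nhds 0) := by
    simpa using tendsto_inv_four_pow.mul_const (Q r x y z + ‖A x y z 0 - x‖)
  have hpos : 0 < δ ^ 2 := by positivity
  filter_upwards [hlim.eventually_lt_const hpos, eventually_ge_atTop 1] with n hn hn1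
  obtain ⟨m, rfl⟩ : ∃ m, n = m + 1 := ⟨n - 1, by omega⟩
  have h1 : δ ^ 2 ≤ ‖xs x y z (m + 1)‖ := by
    rw [← norm_sqrt_sq]
    exact pow_le_pow_left₀ hδ.le ((hb m).1.trans (Complex.re_le_norm _)) 2
  have h2 : ‖xs x y z (m + 1)‖ ≤ ‖A x y z (m + 1)‖ + ((4 : ℝ) ^ (m + 1))⁻¹ * ‖A x y z 0 - x‖ := by
    have e : xs x y z (m + 1) = A x y z (m + 1) - (A x y z 0 - x) / 4 ^ (m + 1) := by
      rw [← A_sub_xs]; ring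
    have e2 : ‖(A x y z 0 - x) / 4 ^ (m + 1)‖ = ((4 : ℝ) ^ (m + 1))⁻¹ * ‖A x y z 0 - x‖ := by
      rw [norm_div, norm_pow, div_eq_inv_mul]; norm_num
    rw [← e2]
    conv_lhs => rw [e]
    exact norm_sub_le _ _
  rw [Stop]
  rw [mul_add] at hn
  linarith

/-- R_D is bounded uniformly along the iteration, so the remainder is O(4^{-n}). This limit is what
makes R_D inherit homogeneity from S_n. -/
lemma tendsto_sumTerm {x y z : ℂ} (h : Admissible x y z) :
    Tendsto (sumTerm x y z) atTop (nhds (RD x y z)) := by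
  obtain ⟨δ, hδ, hb⟩ := exists_le_re_sqrt_iterate h
  rw [tendsto_iff_norm_sub_tendsto_zero]
  have hlim : Tendsto (fun n : ℕ => ((4 : ℝ) ^ n)⁻¹ * (6 * (δ ^ 3)⁻¹)) atTop (nhds 0) := by
    simpa using tendsto_inv_four_pow.mul_const (6 * (δ ^ 3)⁻¹)
  refine squeeze_zero' (Eventually.of_forall fun _ => norm_nonneg _) ?_ hlim
  filter_upwards [eventually_ge_atTop 1] with n hn1
  obtain ⟨m, rfl⟩ : ∃ m, n = m + 1 := ⟨n - 1, by omega⟩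
  rw [RD_eq_iterate h (m + 1), sub_add_cancel_right, norm_neg, norm_mul, norm_inv, norm_pow]
  norm_num only [Complex.norm_ofNat]
  gcongr
  exact norm_RD_le hδ (hb m).1 (hb m).2.1 (hb m).2.2

/-! ### Homogeneity under complex scaling -/

lemma sqrt_mul_of_re_mul_pos {u p : ℂ} (h : 0 < (u.sqrt * p.sqrt).re) :
    (u * p).sqrt = u.sqrt * p.sqrt :=
  sqrt_eq_of_sq (by rw [mul_pow, sqrt_sq, sqrt_sq]) h

lemma re_half_mul_pos {σ a b : ℂ} (ha : 0 < (σ * a).re) (hb : 0 < (σ * b).re) :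
    0 < (σ * ((a + b) / 2)).re := by
  rw [show σ * ((a + b) / 2) = (σ * a + σ * b) / ((2 : ℝ) : ℂ) by push_cast; ring,
    Complex.div_ofReal_re, Complex.add_re]
  linarith

/-- √σ√p and √σ√q lie in the right half-plane and have squares σp and σq there too, so their product
σ√p√q also lies there. -/
lemma re_mul_sqrt_mul_sqrt_pos {σ p q : ℂ} (hσ : 0 < σ.re) (hp : 0 < p.re) (hq : 0 < q.re)
    (hp' : 0 < (σ * p).re) (hq' : 0 < (σ * q).re) : 0 < (σ * (p.sqrt * q.sqrt)).re := by
  have key : ∀ w : ℂ, 0 < w.re → 0 < (σ * w).re →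
      0 < (σ.sqrt * w.sqrt).re ∧ 0 < ((σ.sqrt * w.sqrt) ^ 2).re := fun w hw hw' =>
    ⟨re_sqrt_mul_sqrt_pos hσ hw, by rwa [mul_pow, sqrt_sq, sqrt_sq]⟩
  have h1 := key p hp hp'
  have h2 := key q hq hq'
  have h := re_mul_pos_of_re_sq_pos h1.1.le h2.1.le h1.2 h2.2
  have e : σ.sqrt * p.sqrt * (σ.sqrt * q.sqrt) = σ * (p.sqrt * q.sqrt) := by
    linear_combination p.sqrt * q.sqrt * sqrt_sq σ
  rwa [e] at h

lemma lam_mul {u p q w : ℂ} (hp : 0 < (u.sqrt * p.sqrt).re) (hq : 0 < (u.sqrt * q.sqrt).re)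
    (hw : 0 < (u.sqrt * w.sqrt).re) : lam (u * p) (u * q) (u * w) = u * lam p q w := by
  rw [lam, lam, sqrt_mul_of_re_mul_pos hp, sqrt_mul_of_re_mul_pos hq, sqrt_mul_of_re_mul_pos hw]
  linear_combination (p.sqrt * q.sqrt + p.sqrt * w.sqrt + q.sqrt * w.sqrt) * sqrt_sq u

/-- Scaling commutes with a step only if √(up) = √u√p and likewise for the others. The branch
conditions ensuring this are carried through the same induction. -/
lemma iterate_mul {u p q w : ℂ} (hu : u ∈ Complex.slitPlane) (hpqw : Admissible p q w)
    (hp : 0 < (u.sqrt * p.sqrt).re) (hq : 0 < (u.sqrt * q.sqrt).re)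
    (hw : 0 < (u.sqrt * w.sqrt).re) (n : ℕ) :
    (xs (u * p) (u * q) (u * w) n = u * xs p q w n ∧
      ys (u * p) (u * q) (u * w) n = u * ys p q w n ∧
      zs (u * p) (u * q) (u * w) n = u * zs p q w n) ∧
    (0 < (u.sqrt * (xs p q w n).sqrt).re ∧ 0 < (u.sqrt * (ys p q w n).sqrt).re ∧
      0 < (u.sqrt * (zs p q w n).sqrt).re) := by
  induction n with
  | zero => exact ⟨⟨rfl, rfl, rfl⟩, hp, hq, hw⟩
  | succ n ih =>
    obtain ⟨⟨ex, ey, ez⟩, h1, h2, h3⟩ := ih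
    obtain ⟨r1, r2, r3⟩ := (hpqw.iterate n).re_pos
    have hσ := sqrt_re_pos hu
    simp only [xs_succ, ys_succ, zs_succ, ex, ey, ez, lam_mul h1 h2 h3]
    refine ⟨⟨by ring, by ring, by ring⟩, ?_⟩
    rw [step_fst, step_snd, step_trd, sqrt_mul_of_re_pos r1 r2, sqrt_mul_of_re_pos r1 r3,
      sqrt_mul_of_re_pos r2 r3]
    have m1 := re_half_mul_pos h1 h2
    have m2 := re_half_mul_pos h1 h3
    have m3 := re_half_mul_pos h2 h3
    exact ⟨re_mul_sqrt_mul_sqrt_pos hσ r1 r2 m1 m2, re_mul_sqrt_mul_sqrt_pos hσ r1 r3 m1 m3,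
      re_mul_sqrt_mul_sqrt_pos hσ r2 r3 m2 m3⟩

/-- Homogeneity of `R_D` under complex scaling. -/
theorem RD_mul {u p q w : ℂ} (hu : u ∈ Complex.slitPlane) (hpqw : Admissible p q w)
    (hp : 0 < (u.sqrt * p.sqrt).re) (hq : 0 < (u.sqrt * q.sqrt).re)
    (hw : 0 < (u.sqrt * w.sqrt).re) :
    RD (u * p) (u * q) (u * w) = u ^ (-(3 / 2) : ℂ) * RD p q w := by
  have hadm : Admissible (u * p) (u * q) (u * w) := by
    refine admissible_of_mem ?_ ?_ ?_ <;> refine mem_slitPlane_of_sqrt_re_pos ?_ <;>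
      rw [sqrt_mul_of_re_mul_pos] <;> assumption
  have hsum : sumTerm (u * p) (u * q) (u * w) =
      fun n => u ^ (-(3 / 2) : ℂ) * sumTerm p q w n := by
    funext n
    rw [sumTerm, sumTerm, mul_left_comm]
    congr 1
    rw [Finset.mul_sum]
    refine Finset.sum_congr rfl fun m _ => ?_
    obtain ⟨⟨ex, ey, ez⟩, h1, h2, h3⟩ := iterate_mul hu hpqw hp hq hw m
    rw [lams, lams, ex, ey, ez, lam_mul h1 h2 h3, sqrt_mul_of_re_mul_pos h3, cpow_neg_three_half]
    have e : u.sqrt * (zs p q w m).sqrt * (u * zs p q w m +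
        u * lam (xs p q w m) (ys p q w m) (zs p q w m)) = u.sqrt ^ 3 * ((zs p q w m).sqrt *
        (zs p q w m + lam (xs p q w m) (ys p q w m) (zs p q w m))) := by
      linear_combination (-u.sqrt * (zs p q w m).sqrt * (zs p q w m +
        lam (xs p q w m) (ys p q w m) (zs p q w m))) * sqrt_sq u
    rw [e, div_eq_mul_inv, div_eq_mul_inv, mul_inv]
    ring
  refine tendsto_nhds_unique (tendsto_sumTerm hadm) ?_
  rw [hsum]
  exact (tendsto_sumTerm hpqw).const_mul _

/-! ### Convex hulls in the cut plane -/

/-- Every convex combination of `x, y, z` lies in the cut plane. -/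
def ConvexCut (x y z : ℂ) : Prop :=
  ∀ α β γ : ℝ, 0 ≤ α → 0 ≤ β → 0 ≤ γ → α + β + γ = 1 →
    (α : ℂ) * x + β * y + γ * z ∈ Complex.slitPlane

lemma convexCut_of_convexHull_subset {x y z : ℂ}
    (h : convexHull ℝ {x, y, z} ⊆ Complex.slitPlane) : ConvexCut x y z := by
  intro α β γ hα hβ hγ hs
  apply h
  have hx : x ∈ convexHull ℝ {x, y, z} := subset_convexHull ℝ _ (by simp)
  have hy : y ∈ convexHull ℝ {x, y, z} := subset_convexHull ℝ _ (by simp)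
  have hz : z ∈ convexHull ℝ {x, y, z} := subset_convexHull ℝ _ (by simp)
  have hw : ∀ i : Fin 3, (![x, y, z] : Fin 3 → ℂ) i ∈ convexHull ℝ {x, y, z} := by
    intro i
    fin_cases i <;> assumption
  have := (convex_convexHull ℝ ({x, y, z} : Set ℂ)).sum_mem (t := Finset.univ)
    (w := (![α, β, γ] : Fin 3 → ℝ)) (z := ![x, y, z])
    (by intro i _; fin_cases i <;> assumption) (by simpa [Fin.sum_univ_three] using hs)
    (fun i _ => hw i)
  simpa [Fin.sum_univ_three] using this

lemma re_inv_nonneg {w : ℂ} (h : 0 ≤ w.re) : 0 ≤ (w⁻¹).re := by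
  rw [Complex.inv_re]; exact div_nonneg h (Complex.normSq_nonneg _)

lemma re_inv_pos {w : ℂ} (h : 0 < w.re) : 0 < (w⁻¹).re := by
  rw [Complex.inv_re]
  exact div_pos h (Complex.normSq_pos.2 fun h0 => by simp [h0] at h)

/-- With m = αq + βp the convex combination is W = sm + γqp. If W were real and nonpositive and m ≠
0, then s = W/m - γ/(α/p + β/q) would have nonpositive real part. If Re m = 0, then α = β = 0 and W
= qp. -/
lemma convexCut_mul {p q s : ℂ} (hp : 0 < p.re) (hq : 0 < q.re) (hs : 0 < s.re) :
    ConvexCut (s * q) (s * p) (q * p) := by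
  intro α β γ hα hβ hγ hsum
  have hne : ∀ w : ℂ, 0 < w.re → w ≠ 0 := fun w hw h0 => by simp [h0] at hw
  set m : ℂ := α * q + β * p with hm
  have hmre : m.re = α * q.re + β * p.re := by simp [hm]
  rcases (by positivity : 0 ≤ α * q.re + β * p.re).eq_or_lt with h0 | h0
  · have hα0 : α = 0 := by
      by_contra hne
      have : 0 < α * q.re := mul_pos (lt_of_le_of_ne hα (Ne.symm hne)) hq
      nlinarith [mul_nonneg hβ hp.le]
    have hβ0 : β = 0 := by
      by_contra hne
      have : 0 < β * p.re := mul_pos (lt_of_le_of_ne hβ (Ne.symm hne)) hp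
      nlinarith [mul_nonneg hα hq.le]
    have hγ1 : γ = 1 := by linarith
    simpa [hα0, hβ0, hγ1] using mul_mem_slitPlane hq hp
  · rw [← hmre] at h0
    by_contra hW
    rw [Complex.mem_slitPlane_iff, not_or, not_lt, not_not] at hW
    set W : ℂ := (α : ℂ) * (s * q) + β * (s * p) + γ * (q * p) with hWdef
    have hWre : W = ((W.re : ℝ) : ℂ) := Complex.ext rfl (by simpa using hW.2)
    have hm0 := hne m h0
    have hp0 := hne p hp
    have hq0 := hne q hq
    have hv : 0 < ((α : ℂ) * p⁻¹ + β * q⁻¹).re := by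
      simp only [Complex.add_re, Complex.re_ofReal_mul]
      have h1 := re_inv_pos hp
      have h2 := re_inv_pos hq
      rcases hα.eq_or_lt with hα' | hα'
      · rcases hβ.eq_or_lt with hβ' | hβ'
        · rw [hmre, ← hα', ← hβ'] at h0; simp at h0
        · have := mul_pos hβ' h2; have := mul_nonneg hα h1.le; linarith
      · have := mul_pos hα' h1; have := mul_nonneg hβ h2.le; linarith
    have hv' : (α : ℂ) * p⁻¹ + β * q⁻¹ = m * (q * p)⁻¹ := by
      rw [hm]; field_simp
    have hs' : s = (W.re : ℂ) * m⁻¹ - γ * ((α : ℂ) * p⁻¹ + β * q⁻¹)⁻¹ := by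
      rw [hv', ← hWre, mul_inv, inv_inv, hWdef]
      have : (α : ℂ) * (s * q) + β * (s * p) = s * m := by rw [hm]; ring
      rw [this]
      field_simp
      ring
    have := congrArg Complex.re hs'
    rw [Complex.sub_re, Complex.re_ofReal_mul, Complex.re_ofReal_mul] at this
    have h1 := mul_nonneg hγ (re_inv_nonneg hv.le)
    have h2 := mul_nonneg (neg_nonneg.2 hW.1) (re_inv_nonneg h0.le)
    linarith

lemma Admissible.convexCut_step {x y z : ℂ} (h : Admissible x y z) :
    ConvexCut ((x + lam x y z) / 4) ((y + lam x y z) / 4) ((z + lam x y z) / 4) := by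
  obtain ⟨h1, h2, h3⟩ := h.re_pos
  rw [step_fst, step_snd, step_trd]
  exact convexCut_mul h3 h2 h1

/-- Along the segment from 1 to p the product of roots is never purely imaginary, since its square
avoids the cut. Its real part is Re √u > 0 at the start, hence stays positive by the intermediate
value theorem. -/
lemma re_sqrt_mul_sqrt_pos_of_segment {u p : ℂ}
    (h : ∀ τ : ℝ, 0 ≤ τ → τ ≤ 1 → u * (1 + τ * (p - 1)) ∈ Complex.slitPlane)
    (hp : 0 < p.re) : 0 < (u.sqrt * p.sqrt).re := by
  set f : ℝ → ℝ := fun τ => (u.sqrt * (1 + τ * (p - 1)).sqrt).re with hf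
  have hcont : ContinuousOn f (Set.Icc 0 1) := by
    intro τ hτ
    refine ContinuousAt.continuousWithinAt ?_
    refine Complex.continuous_re.continuousAt.comp (continuousAt_const.mul ?_)
    refine ContinuousAt.comp (f := fun τ : ℝ => 1 + τ * (p - 1)) (g := Complex.sqrt)
      (continuousAt_sqrt (Or.inr ?_)) (by fun_prop)
    rw [Complex.mem_slitPlane_iff]
    left
    simp only [Complex.add_re, Complex.one_re, Complex.re_ofReal_mul, Complex.sub_re]
    rcases hτ.2.eq_or_lt with h1 | h1
    · rw [h1]; linarith
    · nlinarith [mul_nonneg hτ.1 hp.le]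
  have hne : ∀ τ ∈ Set.Icc (0 : ℝ) 1, f τ ≠ 0 := by
    intro τ hτ h0
    have h1 : (u.sqrt * (1 + τ * (p - 1)).sqrt) ^ 2 = u * (1 + τ * (p - 1)) := by
      rw [mul_pow, sqrt_sq, sqrt_sq]
    have h2 := h τ hτ.1 hτ.2
    rw [← h1] at h2
    simp only [hf] at h0
    generalize u.sqrt * (1 + τ * (p - 1)).sqrt = g at h0 h2
    rw [Complex.mem_slitPlane_iff, sq, Complex.mul_re, Complex.mul_im, h0] at h2
    rcases h2 with h2 | h2
    · nlinarith [mul_self_nonneg g.im]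
    · simp at h2
  have hu : u ∈ Complex.slitPlane := by simpa using h 0 le_rfl zero_le_one
  have hf0 : 0 < f 0 := by simpa [hf] using sqrt_re_pos hu
  have e1 : f 1 = (u.sqrt * p.sqrt).re := by simp [hf]
  by_contra! hcon
  rw [← e1] at hcon
  obtain ⟨τ, hτ, h0⟩ := intermediate_value_Icc' zero_le_one hcont ⟨hcon, hf0.le⟩
  exact hne τ hτ h0

/-! ### Taylor expansion of the integrand near (1, 1, 1) -/

lemma norm_quadratic_le {x y : ℂ} {ρ : ℝ} (hx : ‖x‖ ≤ ρ) (hy : ‖y‖ ≤ ρ) (a b c : ℝ) :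
    ‖(a : ℂ) * x ^ 2 + b * (x * y) + c * y ^ 2‖ ≤ (|a| + |b| + |c|) * ρ ^ 2 := by
  have hρ : 0 ≤ ρ := (norm_nonneg x).trans hx
  refine norm_add₃_le.trans ?_
  simp only [norm_mul, norm_pow, Complex.norm_real, Real.norm_eq_abs]
  have h1 : ‖x‖ ^ 2 ≤ ρ ^ 2 := by gcongr
  have h2 : ‖x‖ * ‖y‖ ≤ ρ ^ 2 := by rw [sq]; gcongr
  have h3 : ‖y‖ ^ 2 ≤ ρ ^ 2 := by gcongr
  have := mul_le_mul_of_nonneg_left h1 (abs_nonneg a)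
  have := mul_le_mul_of_nonneg_left h2 (abs_nonneg b)
  have := mul_le_mul_of_nonneg_left h3 (abs_nonneg c)
  linarith

lemma norm_third_le {x y : ℂ} {ρ : ℝ} (hx : ‖x‖ ≤ ρ) (hy : ‖y‖ ≤ ρ) :
    ‖-(x + y) / 3‖ ≤ 2 / 3 * ρ := by
  rw [norm_div, norm_neg]
  have := (norm_add_le x y).trans (add_le_add hx hy)
  norm_num
  linarith

section Bounds

variable {x y z : ℂ} {ρ : ℝ}

/-- Eliminating z leaves a quadratic form in x and y, and the constant is the sum of the moduli of
its coefficients: 2/3 + 1/3 + 2/3. The quadratic factors of E₃ and E₄ are treated in the same way.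
-/
lemma norm_E2_le (hx : ‖x‖ ≤ ρ) (hy : ‖y‖ ≤ ρ) (hz : z = -(x + y) / 3) :
    ‖x * y - 6 * z ^ 2‖ ≤ 5 / 3 * ρ ^ 2 := by
  have h := norm_quadratic_le hx hy (-(2 / 3)) (-(1 / 3)) (-(2 / 3))
  have e : x * y - 6 * z ^ 2 = ((-(2 / 3) : ℝ) : ℂ) * x ^ 2 + ((-(1 / 3) : ℝ) : ℂ) * (x * y) +
      ((-(2 / 3) : ℝ) : ℂ) * y ^ 2 := by rw [hz]; push_cast; ring
  rw [e]
  refine h.trans (le_of_eq ?_)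
  norm_num [abs_of_pos]

lemma norm_E3_le (hx : ‖x‖ ≤ ρ) (hy : ‖y‖ ≤ ρ) (hz : z = -(x + y) / 3) :
    ‖(3 * (x * y) - 8 * z ^ 2) * z‖ ≤ 2 * ρ ^ 3 := by
  have hρ : 0 ≤ ρ := (norm_nonneg x).trans hx
  have h := norm_quadratic_le hx hy (-(8 / 9)) (11 / 9) (-(8 / 9))
  have e : 3 * (x * y) - 8 * z ^ 2 = ((-(8 / 9) : ℝ) : ℂ) * x ^ 2 + ((11 / 9 : ℝ) : ℂ) * (x * y) +
      ((-(8 / 9) : ℝ) : ℂ) * y ^ 2 := by rw [hz]; push_cast; ring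
  have h' : ‖3 * (x * y) - 8 * z ^ 2‖ ≤ 3 * ρ ^ 2 := by
    rw [e]
    refine h.trans (le_of_eq ?_)
    norm_num [abs_of_pos]
  have hz' : ‖z‖ ≤ 2 / 3 * ρ := hz ▸ norm_third_le hx hy
  rw [norm_mul]
  calc _ ≤ 3 * ρ ^ 2 * (2 / 3 * ρ) := by gcongr
    _ = _ := by ring

lemma norm_E4_le (hx : ‖x‖ ≤ ρ) (hy : ‖y‖ ≤ ρ) (hz : z = -(x + y) / 3) :
    ‖3 * (x * y - z ^ 2) * z ^ 2‖ ≤ 4 / 3 * ρ ^ 4 := by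
  have hρ : 0 ≤ ρ := (norm_nonneg x).trans hx
  have h := norm_quadratic_le hx hy (-(1 / 3)) (7 / 3) (-(1 / 3))
  have e : 3 * (x * y - z ^ 2) = ((-(1 / 3) : ℝ) : ℂ) * x ^ 2 + ((7 / 3 : ℝ) : ℂ) * (x * y) +
      ((-(1 / 3) : ℝ) : ℂ) * y ^ 2 := by rw [hz]; push_cast; ring
  have h' : ‖3 * (x * y - z ^ 2)‖ ≤ 3 * ρ ^ 2 := by
    rw [e]
    refine h.trans (le_of_eq ?_)
    norm_num [abs_of_pos]
  have hz' : ‖z‖ ≤ 2 / 3 * ρ := hz ▸ norm_third_le hx hy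
  rw [norm_mul, norm_pow]
  calc _ ≤ 3 * ρ ^ 2 * (2 / 3 * ρ) ^ 2 := by gcongr
    _ = _ := by ring

lemma norm_E5_le (hx : ‖x‖ ≤ ρ) (hy : ‖y‖ ≤ ρ) (hz : z = -(x + y) / 3) :
    ‖x * y * z ^ 3‖ ≤ 8 / 27 * ρ ^ 5 := by
  have hρ : 0 ≤ ρ := (norm_nonneg x).trans hx
  have hz' : ‖z‖ ≤ 2 / 3 * ρ := hz ▸ norm_third_le hx hy
  rw [norm_mul, norm_mul, norm_pow]
  calc _ ≤ ρ * ρ * (2 / 3 * ρ) ^ 3 := by gcongr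
    _ = _ := by ring

end Bounds

/-- The Taylor polynomial of degree `5` of the inverse square root of
`1 + E₂ v² - E₃ v³ + E₄ v⁴ - E₅ v⁵` at `v = 1`. -/
noncomputable def taylorInvSqrt (e₂ e₃ e₄ e₅ : ℂ) : ℂ :=
  1 - e₂ / 2 + e₃ / 2 + (3 / 8 * e₂ ^ 2 - e₄ / 2) + (e₅ / 2 - 3 / 4 * (e₂ * e₃))

section Bounds

variable {e₂ e₃ e₄ e₅ : ℂ} {ρ : ℝ}

lemma norm_quintic_le (hρ : 0 ≤ ρ) (hρ' : ρ ≤ 0.172) (h2 : ‖e₂‖ ≤ 5 / 3 * ρ ^ 2)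
    (h3 : ‖e₃‖ ≤ 2 * ρ ^ 3) (h4 : ‖e₄‖ ≤ 4 / 3 * ρ ^ 4) (h5 : ‖e₅‖ ≤ 8 / 27 * ρ ^ 5) :
    ‖e₂ - e₃ + e₄ - e₅‖ ≤ 2.06 * ρ ^ 2 := by
  have h : ‖e₂ - e₃ + e₄ - e₅‖ ≤ ‖e₂‖ + ‖e₃‖ + ‖e₄‖ + ‖e₅‖ := by
    refine (norm_sub_le _ _).trans ?_
    gcongr
    refine (norm_add_le _ _).trans ?_
    gcongr
    exact norm_sub_le _ _
  have a3 : ρ ^ 3 ≤ 0.172 * ρ ^ 2 := by rw [pow_succ']; gcongr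
  have a4 : ρ ^ 4 ≤ 0.172 * ρ ^ 3 := by rw [pow_succ' ρ 3]; gcongr
  have a5 : ρ ^ 5 ≤ 0.172 * ρ ^ 4 := by rw [pow_succ' ρ 4]; gcongr
  have : 0 ≤ ρ ^ 2 := by positivity
  linarith

lemma norm_taylorInvSqrt_sub_one_le (hρ : 0 ≤ ρ) (hρ' : ρ ≤ 0.172) (h2 : ‖e₂‖ ≤ 5 / 3 * ρ ^ 2)
    (h3 : ‖e₃‖ ≤ 2 * ρ ^ 3) (h4 : ‖e₄‖ ≤ 4 / 3 * ρ ^ 4) (h5 : ‖e₅‖ ≤ 8 / 27 * ρ ^ 5) :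
    ‖taylorInvSqrt e₂ e₃ e₄ e₅ - 1‖ ≤ 0.05 := by
  have hb := norm_quintic_le hρ hρ' h2 h3 h4 h5
  have e : taylorInvSqrt e₂ e₃ e₄ e₅ - 1 =
      -(1 / 2) * (e₂ - e₃ + e₄ - e₅) + 3 / 8 * (e₂ * (e₂ - 2 * e₃)) := by
    rw [taylorInvSqrt]; ring
  have h23 : ‖e₂ - 2 * e₃‖ ≤ ‖e₂‖ + 2 * ‖e₃‖ := by
    refine (norm_sub_le _ _).trans ?_
    rw [norm_mul]; norm_num
  have r2 : ρ ^ 2 ≤ 0.0296 := (pow_le_pow_left₀ hρ hρ' 2).trans (by norm_num)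
  have r3 : ρ ^ 3 ≤ 0.0052 := (pow_le_pow_left₀ hρ hρ' 3).trans (by norm_num)
  have b2 : ‖e₂‖ ≤ 0.05 := by linarith
  have b23 : ‖e₂ - 2 * e₃‖ ≤ 0.08 := by linarith
  have hprod : ‖e₂ * (e₂ - 2 * e₃)‖ ≤ 0.05 * 0.08 := by rw [norm_mul]; gcongr
  rw [e]
  refine (norm_add_le _ _).trans ?_
  rw [norm_mul, norm_mul (3 / 8 : ℂ)]
  norm_num at hprod hb ⊢
  linarith

lemma norm_taylorInvSqrt_sq_mul_sub_one_le (hρ : 0 ≤ ρ) (hρ' : ρ ≤ 0.172)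
    (h2 : ‖e₂‖ ≤ 5 / 3 * ρ ^ 2) (h3 : ‖e₃‖ ≤ 2 * ρ ^ 3) (h4 : ‖e₄‖ ≤ 4 / 3 * ρ ^ 4)
    (h5 : ‖e₅‖ ≤ 8 / 27 * ρ ^ 5) :
    ‖taylorInvSqrt e₂ e₃ e₄ e₅ ^ 2 * (1 + (e₂ - e₃ + e₄ - e₅)) - 1‖ ≤ 16 * ρ ^ 6 := by
  have hb := norm_quintic_le hρ hρ' h2 h3 h4 h5
  set b := e₂ - e₃ + e₄ - e₅ with hbdef
  -- d collects the terms of b² of weight at least 6, so the Taylor polynomial equals 1 - b/2 + 3/8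
  -- (b² - d).
  set d := (e₄ - e₃ - e₅) ^ 2 + 2 * e₂ * (e₄ - e₅) with hd
  have a4 : ρ ^ 4 ≤ 0.172 * ρ ^ 3 := by rw [pow_succ' ρ 3]; gcongr
  have a5 : ρ ^ 5 ≤ 0.172 * ρ ^ 4 := by rw [pow_succ' ρ 4]; gcongr
  have p3 : 0 ≤ ρ ^ 3 := by positivity
  have p4 : 0 ≤ ρ ^ 4 := by positivity
  have r2 : ρ ^ 2 ≤ 0.0296 := (pow_le_pow_left₀ hρ hρ' 2).trans (by norm_num)
  have r6 : ρ ^ 6 ≤ 0.0001 := (pow_le_pow_left₀ hρ hρ' 6).trans (by norm_num)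
  have hs : ‖e₄ - e₃ - e₅‖ ≤ 2.3 * ρ ^ 3 := by
    have : ‖e₄ - e₃ - e₅‖ ≤ ‖e₄‖ + ‖e₃‖ + ‖e₅‖ := by
      refine (norm_sub_le _ _).trans ?_
      gcongr
      exact norm_sub_le _ _
    linarith
  have hs' : ‖e₄ - e₅‖ ≤ 1.4 * ρ ^ 4 := by
    have := norm_sub_le e₄ e₅
    linarith
  have hdle : ‖d‖ ≤ 10 * ρ ^ 6 := by
    refine (norm_add_le _ _).trans ?_
    rw [norm_pow, norm_mul, norm_mul, Complex.norm_ofNat]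
    calc _ ≤ (2.3 * ρ ^ 3) ^ 2 + 2 * (5 / 3 * ρ ^ 2) * (1.4 * ρ ^ 4) := by gcongr
      _ ≤ _ := by
        have : 0 ≤ ρ ^ 6 := by positivity
        ring_nf
        linarith
  have e : taylorInvSqrt e₂ e₃ e₄ e₅ ^ 2 * (1 + b) - 1 =
      b ^ 3 * (5 / 8 - 15 / 64 * b + 9 / 64 * b ^ 2) +
        d * ((1 + b) * (-(3 / 4) * (1 - b / 2 + 3 / 8 * b ^ 2) + 9 / 64 * d)) := by
    rw [taylorInvSqrt, hd, hbdef]; ring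
  have hb1 : ‖b‖ ≤ 0.07 := by linarith
  have hd1 : ‖d‖ ≤ 0.001 := by linarith
  have hb2 : ‖b ^ 2‖ ≤ 0.07 ^ 2 := by rw [norm_pow]; gcongr
  have hb3 : ‖b ^ 3‖ ≤ (2.06 * ρ ^ 2) ^ 3 := by rw [norm_pow]; gcongr
  have f1 : ‖5 / 8 - 15 / 64 * b + 9 / 64 * b ^ 2‖ ≤ 0.65 := by
    refine (norm_add_le _ _).trans ((add_le_add_left (norm_sub_le _ _) _).trans ?_)
    rw [norm_mul, norm_mul (9 / 64 : ℂ)]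
    norm_num at hb1 hb2 ⊢
    linarith
  have f2 : ‖-(3 / 4) * (1 - b / 2 + 3 / 8 * b ^ 2) + 9 / 64 * d‖ ≤ 0.8 := by
    have : ‖1 - b / 2 + 3 / 8 * b ^ 2‖ ≤ 1.04 := by
      refine (norm_add_le _ _).trans ((add_le_add_left (norm_sub_le _ _) _).trans ?_)
      rw [norm_div, norm_mul]
      norm_num at hb1 hb2 ⊢
      linarith
    refine (norm_add_le _ _).trans ?_
    rw [norm_mul, norm_mul (9 / 64 : ℂ)]
    norm_num at hd1 this ⊢
    linarith
  have f3 : ‖1 + b‖ ≤ 1.07 := by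
    refine (norm_add_le _ _).trans ?_
    rw [norm_one]; linarith
  rw [e]
  refine (norm_add_le _ _).trans ?_
  rw [norm_mul, norm_mul d, norm_mul (1 + b)]
  calc _ ≤ (2.06 * ρ ^ 2) ^ 3 * 0.65 + 10 * ρ ^ 6 * (1.07 * 0.8) := by gcongr
    _ ≤ _ := by
      have : 0 ≤ ρ ^ 6 := by positivity
      ring_nf
      linarith

lemma norm_mul_sub_one_le {a b : ℂ} {α β : ℝ} (ha : ‖a - 1‖ ≤ α) (hb : ‖b - 1‖ ≤ β) :
    ‖a * b - 1‖ ≤ (1 + α) * (1 + β) - 1 := by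
  have e : a * b - 1 = (a - 1) * (b - 1) + (a - 1) + (b - 1) := by ring
  have hα : 0 ≤ α := (norm_nonneg _).trans ha
  rw [e]
  refine norm_add₃_le.trans ?_
  rw [norm_mul]
  have := mul_le_mul ha hb (norm_nonneg _) hα
  linarith

lemma le_norm_add_one {a : ℂ} {α : ℝ} (ha : ‖a - 1‖ ≤ α) : 2 - α ≤ ‖a + 1‖ := by
  have : ‖(2 : ℂ)‖ ≤ ‖a + 1‖ + ‖a - 1‖ := by
    rw [show (2 : ℂ) = (a + 1) - (a - 1) by ring]
    exact norm_sub_le _ _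
  rw [Complex.norm_ofNat] at this
  linarith

/-- For s = √(1-w), |s-1||s+1| = |w|. The crude |s+1| ≥ 1 gives |s-1| ≤ 0.172; then |s+1| ≥ 1.828
improves this to 0.1. -/
lemma norm_sqrt_one_sub_sub_one_le {w : ℂ} (hw : ‖w‖ ≤ 0.172) : ‖(1 - w).sqrt - 1‖ ≤ 0.1 := by
  set s := (1 - w).sqrt with hs
  have h1 : ‖s - 1‖ * ‖s + 1‖ = ‖w‖ := by
    rw [← norm_mul, show (s - 1) * (s + 1) = -w by linear_combination sqrt_sq (1 - w), norm_neg]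
  have h2 : 1 ≤ ‖s + 1‖ := by
    refine le_trans ?_ (Complex.re_le_norm _)
    rw [Complex.add_re, Complex.one_re]
    linarith [sqrt_re_nonneg (1 - w)]
  have h3 : ‖s - 1‖ ≤ 0.172 := by nlinarith [norm_nonneg (s - 1)]
  have h4 := le_norm_add_one h3
  nlinarith [norm_nonneg (s - 1)]

end Bounds

section Core

variable {x y z : ℂ} {ρ : ℝ}

/-- The degree-`5` Taylor polynomial of `[(1 - x)(1 - y)]^{-1/2} (1 - z)^{-3/2}`. -/
noncomputable def taylorIntegrand (x y z : ℂ) : ℂ :=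
  taylorInvSqrt (x * y - 6 * z ^ 2) ((3 * (x * y) - 8 * z ^ 2) * z)
    (3 * (x * y - z ^ 2) * z ^ 2) (x * y * z ^ 3)

/-- Let k be the product of roots, so k² = 1 + b, and T the Taylor polynomial. Then (k⁻¹ - T) k (Tk
+ 1) = 1 - T²k², which is at most 16ρ⁶ in modulus, and |k||Tk + 1| ≥ 1.6. That Tk is near 1 and not
-1 is where the choice of branch enters. -/
lemma norm_inv_sub_taylorIntegrand_le (hρ' : ρ ≤ 0.172) (hx : ‖x‖ ≤ ρ) (hy : ‖y‖ ≤ ρ)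
    (hz : z = -(x + y) / 3) :
    ‖((1 - x).sqrt * (1 - y).sqrt * (1 - z).sqrt ^ 3)⁻¹ - taylorIntegrand x y z‖ ≤
      10 * ρ ^ 6 := by
  have hρ : 0 ≤ ρ := (norm_nonneg x).trans hx
  have h2 := norm_E2_le hx hy hz
  have h3 := norm_E3_le hx hy hz
  have h4 := norm_E4_le hx hy hz
  have h5 := norm_E5_le hx hy hz
  have hT := norm_taylorInvSqrt_sub_one_le hρ hρ' h2 h3 h4 h5
  have hG := norm_taylorInvSqrt_sq_mul_sub_one_le hρ hρ' h2 h3 h4 h5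
  have hb := norm_quintic_le hρ hρ' h2 h3 h4 h5
  rw [← taylorIntegrand] at hT hG
  set T := taylorIntegrand x y z
  set b := x * y - 6 * z ^ 2 - (3 * (x * y) - 8 * z ^ 2) * z + 3 * (x * y - z ^ 2) * z ^ 2 -
    x * y * z ^ 3 with hbdef
  set k := (1 - x).sqrt * (1 - y).sqrt * (1 - z).sqrt ^ 3 with hk
  have hk2 : k ^ 2 = 1 + b := by
    have : k ^ 2 = ((1 - x).sqrt ^ 2) * ((1 - y).sqrt ^ 2) * ((1 - z).sqrt ^ 2) ^ 3 := by
      rw [hk]; ring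
    rw [this, sqrt_sq, sqrt_sq, sqrt_sq, hbdef, hz]
    ring
  have hz' : ‖z‖ ≤ 2 / 3 * ρ := hz ▸ norm_third_le hx hy
  have sx := norm_sqrt_one_sub_sub_one_le (hx.trans hρ')
  have sy := norm_sqrt_one_sub_sub_one_le (hy.trans hρ')
  have sz := norm_sqrt_one_sub_sub_one_le (show ‖z‖ ≤ 0.172 by linarith)
  have sz3 : ‖(1 - z).sqrt ^ 3 - 1‖ ≤ 0.34 := by
    have h := norm_mul_sub_one_le sz (norm_mul_sub_one_le sz sz)
    rw [show (1 - z).sqrt ^ 3 = (1 - z).sqrt * ((1 - z).sqrt * (1 - z).sqrt) by ring]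
    exact h.trans (by norm_num)
  have hk0 : ‖k - 1‖ ≤ 0.63 :=
    (norm_mul_sub_one_le (norm_mul_sub_one_le sx sy) sz3).trans (by norm_num)
  have r2 : ρ ^ 2 ≤ 0.0296 := (pow_le_pow_left₀ hρ hρ' 2).trans (by norm_num)
  -- The crude bound 0.63 only serves to keep k + 1 away from 0; then k - 1 = b/(k + 1) is sharper.
  have hk1 : ‖k - 1‖ ≤ 0.05 := by
    have h1 : ‖k - 1‖ * ‖k + 1‖ = ‖b‖ := by
      rw [← norm_mul, show (k - 1) * (k + 1) = b by linear_combination hk2]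
    have := le_norm_add_one hk0
    nlinarith [norm_nonneg (k - 1)]
  have hTk := le_norm_add_one (norm_mul_sub_one_le hT hk1)
  have hkn : 0.95 ≤ ‖k‖ := by
    have : ‖(1 : ℂ)‖ ≤ ‖k‖ + ‖k - 1‖ := by
      rw [show (1 : ℂ) = k - (k - 1) by ring]
      simpa using norm_sub_le k (k - 1)
    rw [norm_one] at this
    linarith
  have hk00 : k ≠ 0 := by
    rw [← norm_pos_iff]; linarith
  have hprod : ‖k⁻¹ - T‖ * (‖k‖ * ‖T * k + 1‖) ≤ 16 * ρ ^ 6 := by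
    rw [← norm_mul, ← norm_mul]
    have e : (k⁻¹ - T) * (k * (T * k + 1)) = -(T ^ 2 * (1 + b) - 1) := by
      rw [← hk2]; field_simp; ring
    rw [e, norm_neg]
    exact hG
  have h1 : (1.6 : ℝ) ≤ ‖k‖ * ‖T * k + 1‖ := by
    calc (1.6 : ℝ) ≤ 0.95 * (2 - ((1 + 0.05) * (1 + 0.05) - 1)) := by norm_num
      _ ≤ _ := by gcongr
  nlinarith [norm_nonneg (k⁻¹ - T)]

end Core

/-! ### R_D near (1, 1, 1) -/

lemma norm_poly_sub_one_le {x y z : ℂ} {ρ : ℝ} (hρ' : ρ ≤ 0.172) (hx : ‖x‖ ≤ ρ) (hy : ‖y‖ ≤ ρ)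
    (hz : z = -(x + y) / 3) : ‖poly x y z - 1‖ ≤ 0.1 := by
  have hρ : 0 ≤ ρ := (norm_nonneg x).trans hx
  have h2 := norm_E2_le hx hy hz
  have h3 := norm_E3_le hx hy hz
  have h4 := norm_E4_le hx hy hz
  have h5 := norm_E5_le hx hy hz
  rw [poly]
  generalize x * y - 6 * z ^ 2 = e₂ at *
  generalize (3 * (x * y) - 8 * z ^ 2) * z = e₃ at *
  generalize 3 * (x * y - z ^ 2) * z ^ 2 = e₄ at *
  generalize x * y * z ^ 3 = e₅ at *
  have r2 : ρ ^ 2 ≤ 0.0296 := (pow_le_pow_left₀ hρ hρ' 2).trans (by norm_num)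
  have r3 : ρ ^ 3 ≤ 0.0052 := (pow_le_pow_left₀ hρ hρ' 3).trans (by norm_num)
  have r4 : ρ ^ 4 ≤ 0.001 := (pow_le_pow_left₀ hρ hρ' 4).trans (by norm_num)
  have r5 : ρ ^ 5 ≤ 0.001 := (pow_le_pow_left₀ hρ hρ' 5).trans (by norm_num)
  have b2 : ‖e₂‖ ≤ 0.05 := by linarith
  have b3 : ‖e₃‖ ≤ 0.02 := by linarith
  have b22 : ‖e₂ ^ 2‖ ≤ 0.05 ^ 2 := by rw [norm_pow]; gcongr
  have b23 : ‖e₂ * e₃‖ ≤ 0.05 * 0.02 := by rw [norm_mul]; gcongr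
  have e : series e₂ e₃ e₄ e₅ - 1 = -(3 / 14) * e₂ + 1 / 6 * e₃ + (9 / 88 * e₂ ^ 2 +
      -(3 / 22) * e₄) + (-(9 / 52) * (e₂ * e₃) + 3 / 26 * e₅) := by rw [series]; ring
  rw [e]
  refine (norm_add_le _ _).trans ((add_le_add (norm_add₃_le) (norm_add_le _ _)).trans ?_)
  refine (add_le_add_left (add_le_add_right (norm_add_le _ _) _) _).trans ?_
  simp only [norm_mul (_ / _ : ℂ), norm_mul (-(_ / _) : ℂ)]
  norm_num at b2 b3 b22 b23 h4 h5 ⊢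
  linarith

/-- `R_D` near `(1, 1, 1)`, up to terms of order six. -/
theorem norm_RD_sub_poly_le {x y z : ℂ} {ρ : ℝ} (hρ' : ρ ≤ 0.172) (hx : ‖x‖ ≤ ρ) (hy : ‖y‖ ≤ ρ)
    (hz : z = -(x + y) / 3) :
    ‖RD (1 - x) (1 - y) (1 - z) - poly x y z‖ ≤ 2 * ρ ^ 6 := by
  have hρ : 0 ≤ ρ := (norm_nonneg x).trans hx
  have hz' : ‖z‖ ≤ ρ := (hz ▸ norm_third_le hx hy).trans (by linarith)
  have hslit : ∀ w : ℂ, ‖w‖ ≤ ρ → 0 < (1 - w).re := by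
    intro w hw
    have := (Complex.re_le_norm w).trans hw
    rw [Complex.sub_re, Complex.one_re]
    linarith
  have hadm : Admissible (1 - x) (1 - y) (1 - z) :=
    admissible_of_mem (Complex.mem_slitPlane_iff.2 (Or.inl (hslit x hx)))
      (Complex.mem_slitPlane_iff.2 (Or.inl (hslit y hy)))
      (Complex.mem_slitPlane_iff.2 (Or.inl (hslit z hz')))
  set e₂ := x * y - 6 * z ^ 2 with he₂
  set e₃ := (3 * (x * y) - 8 * z ^ 2) * z with he₃
  set e₄ := 3 * (x * y - z ^ 2) * z ^ 2 with he₄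
  set e₅ := x * y * z ^ 3 with he₅
  let f : ℝ → ℝ → ℂ := fun a t => (((t + 1) ^ a : ℝ) : ℂ)
  have hfint : ∀ a : ℝ, a < -1 → IntegrableOn (f a) (Set.Ioi 0) := fun a ha =>
    (integrableOn_add_rpow_Ioi_of_lt ha (by norm_num)).ofReal
  have hfval : ∀ a : ℝ, a < -1 → ∫ t in Set.Ioi (0 : ℝ), f a t = -1 / (a + 1) := by
    intro a ha
    have := integral_add_rpow_Ioi ha one_pos
    rw [Real.one_rpow] at this
    simp only [f]
    rw [integral_complex_ofReal, this]
    push_cast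
    rfl
  let M : ℝ → ℂ := fun t => f (-(5 / 2)) t + (-e₂ / 2) * f (-(9 / 2)) t +
    e₃ / 2 * f (-(11 / 2)) t + (3 / 8 * e₂ ^ 2 - e₄ / 2) * f (-(13 / 2)) t +
    (e₅ / 2 - 3 / 4 * (e₂ * e₃)) * f (-(15 / 2)) t
  have i1 := hfint (-(5 / 2)) (by norm_num)
  have i2 := (hfint (-(9 / 2)) (by norm_num)).const_mul (-e₂ / 2)
  have i3 := (hfint (-(11 / 2)) (by norm_num)).const_mul (e₃ / 2)
  have i4 := (hfint (-(13 / 2)) (by norm_num)).const_mul (3 / 8 * e₂ ^ 2 - e₄ / 2)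
  have i5 := (hfint (-(15 / 2)) (by norm_num)).const_mul (e₅ / 2 - 3 / 4 * (e₂ * e₃))
  have hMint : IntegrableOn M (Set.Ioi 0) := (((i1.add i2).add i3).add i4).add i5
  -- The weight-N Taylor term carries (t+1)^{-5/2-N}, so integration multiplies it by 3/(3+2N); this
  -- turns the Taylor coefficients into those of the series.
  have hMval : (3 / 2 : ℂ) * ∫ t in Set.Ioi (0 : ℝ), M t = poly x y z := by
    have : ∫ t in Set.Ioi (0 : ℝ), M t = _ := integral_add (((i1.add i2).add i3).add i4) i5
    rw [this]
    have : ∫ t in Set.Ioi (0 : ℝ), _ = _ := integral_add ((i1.add i2).add i3) i4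
    erw [this]
    have : ∫ t in Set.Ioi (0 : ℝ), _ = _ := integral_add (i1.add i2) i3
    erw [this]
    have : ∫ t in Set.Ioi (0 : ℝ), _ = _ := integral_add i1 i2
    erw [this]
    rw [integral_const_mul, integral_const_mul, integral_const_mul, integral_const_mul,
      hfval _ (by norm_num), hfval _ (by norm_num), hfval _ (by norm_num), hfval _ (by norm_num),
      hfval _ (by norm_num), poly, ← he₂, ← he₃, ← he₄, ← he₅, series]
    push_cast
    ring
  have hbound : ∀ t : ℝ, 0 < t →
      ‖rdIntegrand (1 - x) (1 - y) (1 - z) t - M t‖ ≤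
        10 * ρ ^ 6 * (t + 1) ^ (-(17 / 2) : ℝ) := by
    intro t ht
    have ht1 : 0 < t + 1 := by linarith
    set v : ℝ := (t + 1)⁻¹ with hv
    have hv0 : 0 < v := by positivity
    have hv1 : v ≤ 1 := inv_le_one_of_one_le₀ (by linarith)
    have hnv : ∀ w : ℂ, ‖w‖ ≤ ρ → ‖(v : ℂ) * w‖ ≤ v * ρ := by
      intro w hw
      rw [norm_mul, Complex.norm_of_nonneg hv0.le]
      gcongr
    have hvρ : v * ρ ≤ ρ := mul_le_of_le_one_left hρ hv1
    -- Since t + 1 - w = (t+1)(1 - vw), the Taylor estimate is applied to vx, vy, vz and gains the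
    -- factor v⁶.
    have hcore := norm_inv_sub_taylorIntegrand_le (hvρ.trans hρ') (hnv x hx) (hnv y hy)
      (z := v * z) (by rw [hz]; ring)
    have hsq : ∀ w : ℂ, ‖w‖ ≤ ρ →
        ((t : ℂ) + (1 - w)).sqrt = ((√(t + 1) : ℝ) : ℂ) * (1 - v * w).sqrt := by
      intro w hw
      have hn0 : (t : ℂ) + 1 ≠ 0 := by exact_mod_cast ht1.ne'
      refine sqrt_eq_of_sq ?_ ?_
      · rw [mul_pow, sqrt_sq, ← Complex.ofReal_pow, Real.sq_sqrt ht1.le, hv]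
        push_cast
        field_simp
        ring
      · rw [Complex.re_ofReal_mul]
        exact mul_pos (Real.sqrt_pos.2 ht1) (sqrt_re_pos (Complex.mem_slitPlane_iff.2
          (Or.inl (hslit _ ((hnv w hw).trans hvρ)))))
    have hpow : (√(t + 1) ^ 5)⁻¹ = (t + 1) ^ (-(5 / 2) : ℝ) := by
      rw [Real.sqrt_eq_rpow, ← Real.rpow_natCast, ← Real.rpow_mul ht1.le, ← Real.rpow_neg ht1.le]
      norm_num
    have hint : rdIntegrand (1 - x) (1 - y) (1 - z) t = f (-(5 / 2)) t *
        ((1 - v * x).sqrt * (1 - v * y).sqrt * (1 - v * z).sqrt ^ 3)⁻¹ := by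
      rw [rdIntegrand_eq, hsq x hx, hsq y hy, hsq z hz']
      simp only [f]
      rw [← hpow]
      push_cast
      rw [← mul_inv]
      congr 1
      ring
    have hf : ∀ (a : ℝ) (N : ℕ), a = -(5 / 2) - N → f a t = f (-(5 / 2)) t * (v : ℂ) ^ N := by
      intro a N ha
      simp only [f]
      rw [ha, Real.rpow_sub ht1, Real.rpow_natCast, hv]
      push_cast
      rw [inv_pow, div_eq_mul_inv]
    have hM : M t = f (-(5 / 2)) t * taylorIntegrand (v * x) (v * y) (v * z) := by
      simp only [M]
      rw [hf (-(9 / 2)) 2 (by norm_num), hf (-(11 / 2)) 3 (by norm_num),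
        hf (-(13 / 2)) 4 (by norm_num), hf (-(15 / 2)) 5 (by norm_num), taylorIntegrand,
        taylorInvSqrt, he₂, he₃, he₄, he₅]
      ring
    rw [hint, hM, ← mul_sub, norm_mul]
    have hfn : ‖f (-(5 / 2)) t‖ = (t + 1) ^ (-(5 / 2) : ℝ) := by
      simp only [f]
      exact Complex.norm_of_nonneg (by positivity)
    have h17 : (t + 1) ^ (-(17 / 2) : ℝ) = (t + 1) ^ (-(5 / 2) : ℝ) * v ^ 6 := by
      rw [show (-(17 / 2) : ℝ) = -(5 / 2) - (6 : ℕ) by norm_num, Real.rpow_sub ht1,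
        Real.rpow_natCast, hv, inv_pow, div_eq_mul_inv]
    rw [hfn, h17]
    calc _ ≤ (t + 1) ^ (-(5 / 2) : ℝ) * (10 * (v * ρ) ^ 6) := by gcongr
      _ = _ := by ring
  have hmain : ‖∫ t in Set.Ioi (0 : ℝ), (rdIntegrand (1 - x) (1 - y) (1 - z) t - M t)‖ ≤
      ∫ t in Set.Ioi (0 : ℝ), 10 * ρ ^ 6 * (t + 1) ^ (-(17 / 2) : ℝ) := by
    refine norm_integral_le_of_norm_le
      ((integrableOn_add_rpow_Ioi_of_lt (by norm_num) (by norm_num)).const_mul _) ?_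
    filter_upwards [ae_restrict_mem measurableSet_Ioi] with t ht
    exact hbound t ht
  rw [integral_const_mul, integral_add_rpow_Ioi (by norm_num) one_pos, Real.one_rpow,
    integral_sub (integrableOn_rdIntegrand hadm) hMint] at hmain
  rw [RD, ← hMval, ← mul_sub, norm_mul]
  have : ‖(3 / 2 : ℂ)‖ = 3 / 2 := by norm_num
  rw [this]
  -- The integral of (t+1)^{-17/2} is 2/15, and 3/2 · 10 · 2/15 = 2.
  norm_num at hmain
  linarith

/-! ### The relative error of the power-series term -/

lemma Admissible.convexCut_iterate {x y z : ℂ} (h : Admissible x y z) {n : ℕ}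
    (h0 : n = 0 → ConvexCut x y z) : ConvexCut (xs x y z n) (ys x y z n) (zs x y z n) := by
  cases n with
  | zero => exact h0 rfl
  | succ m => exact (h.iterate m).convexCut_step

lemma pow_six_rpow {r : ℝ} (hr0 : 0 < r) : ((r / 4) ^ (1 / 6 : ℝ)) ^ 6 = r / 4 := by
  rw [← Real.rpow_natCast, ← Real.rpow_mul (by positivity)]
  norm_num

lemma rpow_sixth_le {r : ℝ} (hr0 : 0 < r) (hr : r < 1 / 10 ^ 4) :
    (r / 4) ^ (1 / 6 : ℝ) ≤ 0.172 := by
  -- 0.172⁶ is slightly larger than 10⁻⁴/4, which explains the radius 0.172 used in the estimates.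
  refine le_of_pow_le_pow_left₀ (n := 6) (by norm_num) (by norm_num) ?_
  rw [pow_six_rpow hr0]
  norm_num at hr ⊢
  linarith

lemma Stop.bounds {r : ℝ} {x y z : ℂ} {n : ℕ} (hr0 : 0 < r) (h : Stop r x y z n) :
    A x y z n ≠ 0 ∧ ‖X x y z n‖ ≤ (r / 4) ^ (1 / 6 : ℝ) ∧ ‖Y x y z n‖ ≤ (r / 4) ^ (1 / 6 : ℝ) := by
  set q := (r / 4) ^ (1 / 6 : ℝ) with hq
  have hq0 : 0 < q := by positivity
  have hQ : Q r x y z = q⁻¹ * max (max ‖A x y z 0 - x‖ ‖A x y z 0 - y‖) ‖A x y z 0 - z‖ := by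
    rw [Q, Real.rpow_neg (by positivity)]
  rw [Stop, hQ] at h
  set M := max (max ‖A x y z 0 - x‖ ‖A x y z 0 - y‖) ‖A x y z 0 - z‖
  have hx : ‖A x y z 0 - x‖ ≤ M := (le_max_left _ _).trans (le_max_left _ _)
  have hy : ‖A x y z 0 - y‖ ≤ M := (le_max_right _ _).trans (le_max_left _ _)
  have hM : 0 ≤ M := (norm_nonneg _).trans hx
  have hA : 0 < ‖A x y z n‖ := lt_of_le_of_lt (by positivity) h
  have hMle : M ≤ q * (4 ^ n * ‖A x y z n‖) := by
    have := mul_le_mul_of_nonneg_left h.le (show 0 ≤ q * 4 ^ n by positivity)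
    calc M = q * 4 ^ n * (((4 : ℝ) ^ n)⁻¹ * (q⁻¹ * M)) := by field_simp
      _ ≤ _ := this
      _ = _ := by ring
  have key : ∀ w : ℂ, ‖w‖ ≤ M → ‖w / (4 ^ n * A x y z n)‖ ≤ q := by
    intro w hw
    rw [norm_div, norm_mul, norm_pow, Complex.norm_ofNat, div_le_iff₀ (by positivity)]
    exact hw.trans hMle
  exact ⟨norm_pos_iff.1 hA, key _ hx, key _ hy⟩

lemma xs_eq_mul {x y z : ℂ} {n : ℕ} (hA : A x y z n ≠ 0) :
    xs x y z n = A x y z n * (1 - X x y z n) := by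
  have := A_sub_xs x y z n
  rw [X, ← div_div, ← this]
  field_simp
  ring

lemma ys_eq_mul {x y z : ℂ} {n : ℕ} (hA : A x y z n ≠ 0) :
    ys x y z n = A x y z n * (1 - Y x y z n) := by
  have := A_sub_ys x y z n
  rw [Y, ← div_div, ← this]
  field_simp
  ring

lemma zs_eq_mul {x y z : ℂ} {n : ℕ} (hA : A x y z n ≠ 0) :
    zs x y z n = A x y z n * (1 - Z x y z n) := by
  have hx := xs_eq_mul hA
  have hy := ys_eq_mul hA
  have h := A_eq x y z n
  rw [Z]
  linear_combination (-5 / 3) * h - (1 / 3) * hx - (1 / 3) * hy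

/-- The error bound for the power-series term. -/
theorem relErrorLT_mainTerm {x y z : ℂ} {r : ℝ} (h : Admissible x y z) (hr0 : 0 < r)
    (hr : r < 1 / 10 ^ 4) {n : ℕ} (hs : Stop r x y z n) (h0 : n = 0 → ConvexCut x y z) :
    A x y z n ∈ Complex.slitPlane ∧
      RelErrorLT r (((4 : ℂ) ^ n)⁻¹ * RD (xs x y z n) (ys x y z n) (zs x y z n))
        (mainTerm x y z n) := by
  obtain ⟨hA, hX, hY⟩ := hs.bounds hr0
  have hq := rpow_sixth_le hr0 hr
  have hq6 := pow_six_rpow hr0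
  have hcut := h.convexCut_iterate h0
  have hZ : ‖Z x y z n‖ ≤ (r / 4) ^ (1 / 6 : ℝ) := by
    rw [Z]
    exact (norm_third_le hX hY).trans (by
      have : 0 ≤ (r / 4) ^ (1 / 6 : ℝ) := by positivity
      linarith)
  -- A_n is the convex combination of x_n, y_n, z_n with weights 1/5, 1/5, 3/5, so the segments from
  -- A_n to the three variables stay in their convex hull.
  have hseg : ∀ τ : ℝ, 0 ≤ τ → τ ≤ 1 →
      A x y z n * (1 + τ * ((1 - X x y z n) - 1)) ∈ Complex.slitPlane ∧
      A x y z n * (1 + τ * ((1 - Y x y z n) - 1)) ∈ Complex.slitPlane ∧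
      A x y z n * (1 + τ * ((1 - Z x y z n) - 1)) ∈ Complex.slitPlane := by
    intro τ h0 h1
    have h1' : 0 ≤ 1 - τ := by linarith
    refine ⟨?_, ?_, ?_⟩
    · convert! hcut ((1 - τ) / 5 + τ) ((1 - τ) / 5) (3 * (1 - τ) / 5) (by positivity)
        (by positivity) (by positivity) (by ring) using 1
      push_cast
      linear_combination (1 - (τ : ℂ)) * A_eq x y z n - (τ : ℂ) * xs_eq_mul hA
    · convert! hcut ((1 - τ) / 5) ((1 - τ) / 5 + τ) (3 * (1 - τ) / 5) (by positivity)
        (by positivity) (by positivity) (by ring) using 1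
      push_cast
      linear_combination (1 - (τ : ℂ)) * A_eq x y z n - (τ : ℂ) * ys_eq_mul hA
    · convert! hcut ((1 - τ) / 5) ((1 - τ) / 5) (3 * (1 - τ) / 5 + τ) (by positivity)
        (by positivity) (by positivity) (by ring) using 1
      push_cast
      linear_combination (1 - (τ : ℂ)) * A_eq x y z n - (τ : ℂ) * zs_eq_mul hA
  have hAs : A x y z n ∈ Complex.slitPlane := by simpa using (hseg 0 le_rfl zero_le_one).1
  have hre : ∀ w : ℂ, ‖w‖ ≤ (r / 4) ^ (1 / 6 : ℝ) → 0 < (1 - w).re := by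
    intro w hw
    have := (Complex.re_le_norm w).trans hw
    rw [Complex.sub_re, Complex.one_re]
    linarith
  have hmem : ∀ w : ℂ, ‖w‖ ≤ (r / 4) ^ (1 / 6 : ℝ) → 1 - w ∈ Complex.slitPlane := fun w hw =>
    Complex.mem_slitPlane_iff.2 (Or.inl (hre w hw))
  have hRD := RD_mul hAs (admissible_of_mem (hmem _ hX) (hmem _ hY) (hmem _ hZ))
    (re_sqrt_mul_sqrt_pos_of_segment (fun τ a b => (hseg τ a b).1) (hre _ hX))
    (re_sqrt_mul_sqrt_pos_of_segment (fun τ a b => (hseg τ a b).2.1) (hre _ hY))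
    (re_sqrt_mul_sqrt_pos_of_segment (fun τ a b => (hseg τ a b).2.2) (hre _ hZ))
  refine ⟨hAs, ?_⟩
  have herr := norm_RD_sub_poly_le hq hX hY (z := Z x y z n) rfl
  have hpoly := norm_poly_sub_one_le hq hX hY (z := Z x y z n) rfl
  have hpoly' : 0.9 ≤ ‖poly (X x y z n) (Y x y z n) (Z x y z n)‖ := by
    have : ‖(1 : ℂ)‖ ≤ ‖poly (X x y z n) (Y x y z n) (Z x y z n)‖ +
        ‖poly (X x y z n) (Y x y z n) (Z x y z n) - 1‖ := by
      simpa using norm_sub_le (poly (X x y z n) (Y x y z n) (Z x y z n))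
        (poly (X x y z n) (Y x y z n) (Z x y z n) - 1)
    rw [norm_one] at this
    linarith
  rw [hq6] at herr
  rw [RelErrorLT, mainTerm, xs_eq_mul hA, ys_eq_mul hA, zs_eq_mul hA, hRD, ← mul_assoc, ← mul_sub,
    norm_mul, norm_mul _ (poly _ _ _)]
  have hc : 0 < ‖((4 : ℂ) ^ n)⁻¹ * A x y z n ^ (-(3 / 2) : ℂ)‖ := by
    rw [norm_pos_iff, cpow_neg_three_half]
    exact mul_ne_zero (inv_ne_zero (pow_ne_zero _ (by norm_num)))
      (inv_ne_zero (pow_ne_zero _ (sqrt_ne_zero hAs)))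
  -- The error factor 2ρ⁶ equals r/2, less than 0.9 r.
  calc _ ≤ ‖((4 : ℂ) ^ n)⁻¹ * A x y z n ^ (-(3 / 2) : ℂ)‖ * (2 * (r / 4)) := by gcongr
    _ < ‖((4 : ℂ) ^ n)⁻¹ * A x y z n ^ (-(3 / 2) : ℂ)‖ *
        (r * ‖poly (X x y z n) (Y x y z n) (Z x y z n)‖) := by
      refine mul_lt_mul_of_pos_left ?_ hc
      nlinarith
    _ = _ := by ring

/-! ### Real variables: positivity of T_n and S_n -/

section Real

open ComplexOrder

lemma sqrt_nonneg_of_nonneg {w : ℂ} (h : 0 ≤ w) : 0 ≤ w.sqrt := by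
  rw [Complex.sqrt_of_nonneg h]
  exact Complex.zero_le_real.2 (Real.sqrt_nonneg _)

lemma inv_nonneg_of_nonneg {w : ℂ} (h : 0 ≤ w) : 0 ≤ w⁻¹ := by
  rw [Complex.nonneg_iff] at h ⊢
  refine ⟨re_inv_nonneg h.1, ?_⟩
  rw [Complex.inv_im, ← h.2]
  simp

lemma nonneg_of_im_eq_zero {w : ℂ} (h : w = 0 ∨ w ∈ Complex.slitPlane) (hi : w.im = 0) :
    0 ≤ w := by
  rw [Complex.nonneg_iff]
  refine ⟨?_, hi.symm⟩
  rcases h with rfl | h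
  · simp
  · rcases Complex.mem_slitPlane_iff.1 h with h | h
    · exact h.le
    · exact absurd hi h

lemma lam_nonneg {x y z : ℂ} (hx : 0 ≤ x) (hy : 0 ≤ y) (hz : 0 ≤ z) : 0 ≤ lam x y z :=
  have hx := sqrt_nonneg_of_nonneg hx
  have hy := sqrt_nonneg_of_nonneg hy
  have hz := sqrt_nonneg_of_nonneg hz
  add_nonneg (add_nonneg (mul_nonneg hx hy) (mul_nonneg hx hz)) (mul_nonneg hy hz)

lemma iterate_nonneg {x y z : ℂ} (hx : 0 ≤ x) (hy : 0 ≤ y) (hz : 0 ≤ z) (n : ℕ) :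
    0 ≤ xs x y z n ∧ 0 ≤ ys x y z n ∧ 0 ≤ zs x y z n := by
  have h4 : (0 : ℂ) ≤ 4⁻¹ := inv_nonneg_of_nonneg (by norm_num)
  induction n with
  | zero => exact ⟨hx, hy, hz⟩
  | succ n ih =>
    obtain ⟨h1, h2, h3⟩ := ih
    have hl := lam_nonneg h1 h2 h3
    simp only [xs_succ, ys_succ, zs_succ, div_eq_mul_inv]
    exact ⟨mul_nonneg (add_nonneg h1 hl) h4, mul_nonneg (add_nonneg h2 hl) h4,
      mul_nonneg (add_nonneg h3 hl) h4⟩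

lemma A_nonneg {x y z : ℂ} (hx : 0 ≤ x) (hy : 0 ≤ y) (hz : 0 ≤ z) (n : ℕ) : 0 ≤ A x y z n := by
  obtain ⟨h1, h2, h3⟩ := iterate_nonneg hx hy hz n
  rw [A_eq, div_eq_mul_inv]
  exact mul_nonneg (add_nonneg (add_nonneg h1 h2) (mul_nonneg (by norm_num) h3))
    (inv_nonneg_of_nonneg (by norm_num))

lemma sumTerm_nonneg {x y z : ℂ} (hx : 0 ≤ x) (hy : 0 ≤ y) (hz : 0 ≤ z) (n : ℕ) :
    0 ≤ sumTerm x y z n := by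
  refine mul_nonneg (by norm_num) (Finset.sum_nonneg fun m _ => ?_)
  obtain ⟨h1, h2, h3⟩ := iterate_nonneg hx hy hz m
  rw [div_eq_mul_inv]
  exact mul_nonneg (inv_nonneg_of_nonneg (pow_nonneg (by norm_num) _))
    (inv_nonneg_of_nonneg (mul_nonneg (sqrt_nonneg_of_nonneg h3)
      (add_nonneg h3 (lam_nonneg h1 h2 h3))))

lemma conj_eq_of_nonneg {w : ℂ} (h : 0 ≤ w) : (starRingEnd ℂ) w = w :=
  Complex.conj_eq_iff_im.2 (Complex.nonneg_iff.1 h).2.symm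

/-- The series is invariant under conjugation, hence real, and it lies within 0.1 of 1. -/
lemma mainTerm_nonneg {x y z : ℂ} {ρ : ℝ} {n : ℕ} (hx : 0 ≤ x) (hy : 0 ≤ y) (hz : 0 ≤ z)
    (hρ : ρ ≤ 0.172) (hX : ‖X x y z n‖ ≤ ρ) (hY : ‖Y x y z n‖ ≤ ρ) : 0 ≤ mainTerm x y z n := by
  have hpoly := norm_poly_sub_one_le hρ hX hY (z := Z x y z n) rfl
  have hA := fun m => conj_eq_of_nonneg (A_nonneg hx hy hz m)
  have cX : (starRingEnd ℂ) (X x y z n) = X x y z n := by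
    simp only [X, map_div₀, map_sub, map_mul, map_pow, hA, conj_eq_of_nonneg hx, map_ofNat]
  have cY : (starRingEnd ℂ) (Y x y z n) = Y x y z n := by
    simp only [Y, map_div₀, map_sub, map_mul, map_pow, hA, conj_eq_of_nonneg hy, map_ofNat]
  have cZ : (starRingEnd ℂ) (Z x y z n) = Z x y z n := by
    simp only [Z, map_div₀, map_neg, map_add, cX, cY, map_ofNat]
  have cP : (starRingEnd ℂ) (poly (X x y z n) (Y x y z n) (Z x y z n)) =
      poly (X x y z n) (Y x y z n) (Z x y z n) := by
    simp only [poly, series, map_div₀, map_sub, map_mul, map_pow, map_add, map_one, cX, cY, cZ,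
      map_ofNat]
  refine mul_nonneg (mul_nonneg (inv_nonneg_of_nonneg (pow_nonneg (by norm_num) _)) ?_) ?_
  · rw [cpow_neg_three_half]
    exact inv_nonneg_of_nonneg (pow_nonneg (sqrt_nonneg_of_nonneg (A_nonneg hx hy hz n)) 3)
  · rw [Complex.nonneg_iff]
    refine ⟨?_, (Complex.conj_eq_iff_im.1 cP).symm⟩
    have := (Complex.abs_re_le_norm _).trans hpoly
    rw [Complex.sub_re, Complex.one_re] at this
    linarith [(abs_le.1 this).1]

lemma norm_le_norm_add_of_nonneg {a b : ℂ} (ha : 0 ≤ a) (hb : 0 ≤ b) : ‖a‖ ≤ ‖a + b‖ := by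
  have e : ∀ w : ℂ, 0 ≤ w → ‖w‖ = w.re := fun w hw => by
    rw [← Complex.re_eq_norm] at hw
    exact hw.symm
  rw [e a ha, e _ (add_nonneg ha hb), Complex.add_re]
  linarith [(Complex.nonneg_iff.1 hb).1]

lemma convexCut_of_pos {x y z : ℂ} (hx : 0 < x.re) (hy : 0 < y.re) (hz : 0 < z.re) :
    ConvexCut x y z := by
  intro α β γ hα hβ hγ hs
  rw [Complex.mem_slitPlane_iff]
  left
  simp only [Complex.add_re, Complex.re_ofReal_mul]
  have hm : 0 < min x.re (min y.re z.re) := lt_min hx (lt_min hy hz)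
  calc 0 < min x.re (min y.re z.re) := hm
    _ = α * min x.re (min y.re z.re) + β * min x.re (min y.re z.re) +
        γ * min x.re (min y.re z.re) := by rw [← add_mul, ← add_mul, hs, one_mul]
    _ ≤ _ := by
      gcongr
      · exact min_le_left _ _
      · exact (min_le_right _ _).trans (min_le_left _ _)
      · exact (min_le_right _ _).trans (min_le_right _ _)

lemma re_pos_of_im_eq_zero {w : ℂ} (h : w = 0 ∨ w ∈ Complex.slitPlane) (hi : w.im = 0)
    (hw : w ≠ 0) : 0 < w.re := by
  rcases Complex.mem_slitPlane_iff.1 (h.resolve_left hw) with h | h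
  · exact h
  · exact absurd hi h

/-- If x = 0 then X = 1 at n = 0, against |X| ≤ 0.172; likewise for y. This is why real variables
need no convex hull hypothesis. -/
lemma Stop.ne_zero {r : ℝ} {x y z : ℂ} (hr0 : 0 < r) (hr : r < 1 / 10 ^ 4)
    (hs : Stop r x y z 0) : x ≠ 0 ∧ y ≠ 0 := by
  obtain ⟨hA, hX, hY⟩ := hs.bounds hr0
  have hq := rpow_sixth_le hr0 hr
  have key : ∀ w : ℂ, w = 0 → ‖(A x y z 0 - w) / (4 ^ 0 * A x y z 0)‖ = 1 := by
    rintro w rfl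
    rw [sub_zero, pow_zero, one_mul, div_self hA, norm_one]
  constructor <;> intro h0
  · rw [X, key x h0] at hX
    linarith
  · rw [Y, key y h0] at hY
    linarith

end Real

/-! ### Assembly -/

lemma relErrorLT_approx {x y z : ℂ} {r : ℝ} (h : Admissible x y z) (hr0 : 0 < r) {n : ℕ}
    (hm : RelErrorLT r (((4 : ℂ) ^ n)⁻¹ * RD (xs x y z n) (ys x y z n) (zs x y z n))
      (mainTerm x y z n)) :
    ‖RD x y z - approx x y z n‖ < r * ‖mainTerm x y z n‖ ∧
      (‖mainTerm x y z n‖ ≤ ‖approx x y z n‖ → RelErrorLT r (RD x y z) (approx x y z n)) := by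
  have h1 : ‖RD x y z - approx x y z n‖ < r * ‖mainTerm x y z n‖ := by
    rw [approx, RD_eq_iterate h n, add_sub_add_right_eq_sub]
    exact hm
  exact ⟨h1, fun hle => h1.trans_le (mul_le_mul_of_nonneg_left hle hr0.le)⟩

end Carlson

theorem mainTheorem4 (x y z : ℂ) (h : Carlson.Admissible x y z)
    (r : ℝ) (hr0 : 0 < r) (hr : r < 1 / 10 ^ 4) :
    -- every quantity in the algorithm is well defined
    (∀ m : ℕ,
      Carlson.Admissible (Carlson.xs x y z m) (Carlson.ys x y z m) (Carlson.zs x y z m) ∧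
      IntegrableOn
        (Carlson.rdIntegrand (Carlson.xs x y z m) (Carlson.ys x y z m) (Carlson.zs x y z m))
        (Set.Ioi 0) ∧
      (Carlson.zs x y z m).sqrt * (Carlson.zs x y z m + Carlson.lams x y z m) ≠ 0) ∧
    -- the stopping criterion is met, from some step on
    (∀ᶠ n : ℕ in atTop, Carlson.Stop r x y z n) ∧
    -- iterated duplication
    (∀ n : ℕ, Carlson.RD x y z =
      ((4 : ℂ) ^ n)⁻¹ *
          Carlson.RD (Carlson.xs x y z n) (Carlson.ys x y z n) (Carlson.zs x y z n) +
        Carlson.sumTerm x y z n) ∧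
    -- the error of the computed value
    (∀ n : ℕ, Carlson.Stop r x y z n →
      (n = 0 → convexHull ℝ {x, y, z} ⊆ Complex.slitPlane) →
      Carlson.A x y z n ∈ Complex.slitPlane ∧
      Carlson.RelErrorLT r
        (((4 : ℂ) ^ n)⁻¹ *
          Carlson.RD (Carlson.xs x y z n) (Carlson.ys x y z n) (Carlson.zs x y z n))
        (Carlson.mainTerm x y z n) ∧
      ‖Carlson.RD x y z - Carlson.approx x y z n‖ < r * ‖Carlson.mainTerm x y z n‖ ∧
      (‖Carlson.mainTerm x y z n‖ ≤ ‖Carlson.approx x y z n‖ →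
        Carlson.RelErrorLT r (Carlson.RD x y z) (Carlson.approx x y z n))) ∧
    -- real variables: the bound on the relative error is rigorous
    (x.im = 0 → y.im = 0 → z.im = 0 → ∀ n : ℕ, Carlson.Stop r x y z n →
      Carlson.RelErrorLT r (Carlson.RD x y z) (Carlson.approx x y z n)) := by
  refine ⟨fun m => ⟨h.iterate m, Carlson.integrableOn_rdIntegrand (h.iterate m),
    (h.iterate m).sqrt_mul_add_lam_ne_zero⟩, Carlson.eventually_stop h r,
    Carlson.RD_eq_iterate h, ?_, ?_⟩
  · intro n hs h0
    obtain ⟨hA, hm⟩ := Carlson.relErrorLT_mainTerm h hr0 hr hs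
      fun hn => Carlson.convexCut_of_convexHull_subset (h0 hn)
    exact ⟨hA, hm, Carlson.relErrorLT_approx h hr0 hm⟩
  · intro hx hy hz n hs
    have hcut : n = 0 → Carlson.ConvexCut x y z := by
      rintro rfl
      obtain ⟨nx, ny⟩ := hs.ne_zero hr0 hr
      exact Carlson.convexCut_of_pos (Carlson.re_pos_of_im_eq_zero h.1 hx nx)
        (Carlson.re_pos_of_im_eq_zero h.2.1 hy ny)
        (Carlson.re_pos_of_im_eq_zero (Or.inr h.2.2.1) hz
          fun h0 => Complex.zero_notMem_slitPlane (h0 ▸ h.2.2.1))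
    have px := Carlson.nonneg_of_im_eq_zero h.1 hx
    have py := Carlson.nonneg_of_im_eq_zero h.2.1 hy
    have pz := Carlson.nonneg_of_im_eq_zero (Or.inr h.2.2.1) hz
    obtain ⟨-, hX, hY⟩ := hs.bounds hr0
    refine (Carlson.relErrorLT_approx h hr0
      (Carlson.relErrorLT_mainTerm h hr0 hr hs hcut).2).2 ?_
    exact Carlson.norm_le_norm_add_of_nonneg
      (Carlson.mainTerm_nonneg px py pz (Carlson.rpow_sixth_le hr0 hr) hX hY)
      (Carlson.sumTerm_nonneg px py pz n)
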